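/- Let $n, m$ be integers with $m\ge 1$, let $\mathbb R_+=[0,\infty)$, and consider the Cauchy problem $$(\partial_t^2-\Delta+b(t)\partial_t)u=0 \ \text{ on } (0,\infty)\times\mathbb R^n,\qquad u(0,\cdot)=u_0,\quad \partial_tu(0,\cdot)=u_1,$$ with solution $u\in C([0,\infty);H^1)\cap C^1([0,\infty);L^2)$ and energy $E(t;u)=\frac12\big(\|\nabla u(t,\cdot)\|^2+\|\partial_tu(t,\cdot)\|^2\big)$, where $\|\cdot\|$ is the $L^2(\mathbb R^n)$ norm. *Data.* Let $\rho$ be a weight function, i.e. $\rho:\mathbb R_+\to(0,\infty)$ is continuous and strictly increasing, $\rho(r)\to\infty$ as $r\to\infty$, and $\zeta(r):=r/\rho(r)$ is strictly increasing on $\mathbb R_+$. With $\hat f(\xi)=(2\pi)^{-n/2}\int_{\mathbb R^n}e^{-ix\cdot\xi}f(x)\,dx$ and $\kappa>0$ put $$\|(u_0,u_1)\|_{\mathcal H(\rho,\kappa)}=\Big(\int_{\mathbb R^n}e^{2\kappa\rho(|\xi|)}\big((1+|\xi|^2)|\hat u_0(\xi)|^2+|\hat u_1(\xi)|^2\big)\,d\xi\Big)^{1/2},$$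 let $\mathcal H(\rho,\kappa)$ be the set of $(u_0,u_1)\in H^1\times L^2$ for which this is finite, and $\mathcal H(\rho,\infty)=\bigcap_{\kappa>0}\mathcal H(\rho,\kappa)$. *Coefficient.* Let $b,\mu:\mathbb R_+\to\mathbb R$, with $\mu$ locally integrable, and put $\sigma=b-\mu$. Assume: * (A1) there is $T\ge0$ such that $\mu(t)>0$ and $\mu'(t)<0$ for all $t\ge T$, and $\sup_{t\ge T}(1+t)\mu(t)<1$; moreover the improper integral $\int_0^\infty\sigma(t)\,dt$ converges; * (A2) $\int_0^\infty\big|\int_s^\infty\sigma(\tau)\,d\tau\big|\,ds<\infty$; * (A3) $b\in C^m(\mathbb R_+)$. Suppose there are a positive, strictly increasing, continuous function $\Theta$ on $\mathbb R_+$ with values in the range $\zeta(\mathbb R_+)$ (so that $\zeta^{-1}(\Theta(t))$ is defined) and a positive, monotone, continuous function $\Xi$ on $\mathbb R_+$ such that, for all $t\ge0$, $$\int_t^\infty\Big|\int_s^\infty\sigma(\tau)\,d\tau\Big|\,ds\le\Theta(t)^{-1},\qquad \Big|\frac{d^k}{dt^k}b(t)\Big|\le\Xi(t)^{k+1}\quad(k=0,\dots,m),$$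 and $$\sup_{t\ge0}\frac{\Xi(t)}{\zeta^{-1}(\Theta(t))}<\infty,\qquad \sup_{t\ge0}\frac{\Theta(t)}{\zeta^{-1}(\Theta(t))^{m+1}}\int_0^t\Xi(s)^{m+1}\,ds<\infty.$$ Then there exist constants $\kappa_0>0$ and $C>0$, independent of $t$ and of the initial data, such that for all $(u_0,u_1)\in\mathcal H(\rho,\infty)$ the solution $u$ satisfies $$E(t;u)\le C\,\|(u_0,u_1)\|_{\mathcal H(\rho,\kappa_0)}^2\exp\Big(-\int_0^t\mu(s)\,ds\Big)\qquad(t\ge0).$$ -/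

import Mathlib

open MeasureTheory Set Filter Topology
open scoped SchwartzMap FourierTransform LineDeriv Laplacian ENNReal

noncomputable section

namespace DissipativeWave

/-- The space `L²(ℝⁿ)` of complex valued functions. -/
abbrev L2 (n : ℕ) : Type := Lp (α := EuclideanSpace ℝ (Fin n)) ℂ 2 volume

/-- An `L²` function, regarded as a tempered distribution on `ℝⁿ`. -/
abbrev toDist {n : ℕ} (f : L2 n) : 𝓢'(EuclideanSpace ℝ (Fin n), ℂ) :=
  Lp.toTemperedDistribution f

/-- `f ∈ H¹(ℝⁿ)`. -/
def MemH1 {n : ℕ} (f : L2 n) : Prop := TemperedDistribution.MemSobolev 1 2 (toDist f)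

open Classical in
/-- The weak partial derivative `∂f/∂x_j` of `f ∈ L²`: the (unique) element of `L²` that represents
the distributional derivative of `f` in the direction of the `j`-th coordinate (and `0` if there is
no such element, which never happens for `f ∈ H¹`). -/
def weakPartial {n : ℕ} (j : Fin n) (f : L2 n) : L2 n :=
  if h : ∃ g : L2 n, ∂_{EuclideanSpace.single j (1 : ℝ)} (toDist f) = toDist g then h.choose else 0

/-- The time derivative of an `L²` valued function on `[0, ∞)` (one-sided at `t = 0`). -/
def timeDeriv {n : ℕ} (u : ℝ → L2 n) (t : ℝ) : L2 n := derivWithin u (Ici 0) t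

/-- The total energy `E(t;u) = (‖∇u(t)‖² + ‖∂ₜu(t)‖²) / 2`. -/
def energy {n : ℕ} (u : ℝ → L2 n) (t : ℝ) : ℝ :=
  1 / 2 * ((∑ j, ‖weakPartial j (u t)‖ ^ 2) + ‖timeDeriv u t‖ ^ 2)

/-- `u ∈ C([0,∞); H¹) ∩ C¹([0,∞); L²)` is the solution of the Cauchy problem
`∂ₜ²u - Δu + b(t) ∂ₜu = 0` on `(0,∞) × ℝⁿ`, `u(0) = u₀`, `∂ₜu(0) = u₁`; the equation is understood
in the sense of tempered distributions in `x`, for every `t > 0`. -/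
structure IsSolution {n : ℕ} (b : ℝ → ℝ) (u₀ u₁ : L2 n) (u : ℝ → L2 n) : Prop where
  memH1 : ∀ t, 0 ≤ t → MemH1 (u t)
  continuousOn_grad : ∀ j, ContinuousOn (fun t => weakPartial j (u t)) (Ici 0)
  contDiffOn : ContDiffOn ℝ 1 u (Ici 0)
  equation : ∀ φ : 𝓢(EuclideanSpace ℝ (Fin n), ℂ), ∀ t, 0 < t →
    HasDerivAt (fun s => toDist (timeDeriv u s) φ)
      ((Δ (toDist (u t))) φ - (b t : ℂ) * toDist (timeDeriv u t) φ) t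
  init : u 0 = u₀
  init_deriv : timeDeriv u 0 = u₁

/-- `ζ(r) = r / ρ(r)`. -/
def zeta (ρ : ℝ → ℝ) (r : ℝ) : ℝ := r / ρ r

/-- The inverse of the function `ζ` on `[0, ∞)`; meaningful on the range `ζ([0, ∞))`. -/
def zetaInv (ρ : ℝ → ℝ) (y : ℝ) : ℝ := Function.invFunOn (zeta ρ) (Ici 0) y

/-- Weight functions on `[0, ∞)`. -/
structure IsWeight (ρ : ℝ → ℝ) : Prop where
  pos : ∀ r, 0 ≤ r → 0 < ρ r
  strictMonoOn : StrictMonoOn ρ (Ici 0)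
  continuousOn : ContinuousOn ρ (Ici 0)
  tendsto : Tendsto ρ atTop atTop
  zeta_strictMonoOn : StrictMonoOn (zeta ρ) (Ici 0)

/-- The Fourier transform on `L²(ℝⁿ)` in the normalization
`f̂(ξ) = (2π)^(-n/2) ∫ exp(-i x·ξ) f(x) dx`, obtained by rescaling Mathlib's
`𝓕 f (η) = ∫ exp(-2πi x·η) f(x) dx`. -/
def fourierHat {n : ℕ} (f : L2 n) (ξ : EuclideanSpace ℝ (Fin n)) : ℂ :=
  (((2 * Real.pi) ^ (-(n : ℝ) / 2) : ℝ) : ℂ) * (𝓕 f : L2 n) ((2 * Real.pi)⁻¹ • ξ)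

/-- The norm of `𝓗(ρ, κ)`, with value in `[0, ∞]`. -/
def hNorm {n : ℕ} (ρ : ℝ → ℝ) (κ : ℝ) (u₀ u₁ : L2 n) : ℝ≥0∞ :=
  (∫⁻ ξ : EuclideanSpace ℝ (Fin n), ENNReal.ofReal (Real.exp (2 * κ * ρ ‖ξ‖) *
    ((1 + ‖ξ‖ ^ 2) * ‖fourierHat u₀ ξ‖ ^ 2 + ‖fourierHat u₁ ξ‖ ^ 2))) ^ (1 / 2 : ℝ)

/-- The space `𝓗(ρ, κ)` of initial data. -/
def hSpace (n : ℕ) (ρ : ℝ → ℝ) (κ : ℝ) : Set (L2 n × L2 n) :=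
  {p | MemH1 p.1 ∧ hNorm ρ κ p.1 p.2 < ∞}

/-- The space `𝓗(ρ, ∞)`, the intersection of all `𝓗(ρ, κ)` with `κ > 0`. -/
def hSpaceTop (n : ℕ) (ρ : ℝ → ℝ) : Set (L2 n × L2 n) :=
  ⋂ κ ∈ Ioi (0 : ℝ), hSpace n ρ κ

/-- The improper integral `∫_s^∞ f(τ) dτ = lim_{R → ∞} ∫_s^R f(τ) dτ`, which may converge
only conditionally. -/
def tailIntegral (f : ℝ → ℝ) (s : ℝ) : ℝ :=
  limUnder atTop (fun R : ℝ => ∫ τ in s..R, f τ)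

/-- Non-effective damping: `μ` is a principal part of `b`. -/
structure NonEffectiveDamping (b μ : ℝ → ℝ) : Prop where
  locallyIntegrable : ∀ t, 0 ≤ t → IntervalIntegrable μ volume 0 t
  eventually_small_pos_decreasing : ∃ T : ℝ, 0 ≤ T ∧
    (∃ μ₀ : ℝ, μ₀ < 1 ∧ IsLUB ((fun t => (1 + t) * μ t) '' Ici T) μ₀) ∧
    (∀ t, T ≤ t → 0 < μ t) ∧
    (∀ t, T ≤ t → derivWithin μ (Ici 0) t < 0)
  converges : ∃ l : ℝ, Tendsto (fun R : ℝ => ∫ s in (0 : ℝ)..R, (b s - μ s)) atTop (𝓝 l)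

/-- Stabilization condition for the oscillating part `σ`. -/
def Stabilization (σ : ℝ → ℝ) : Prop :=
  IntegrableOn (fun s => |tailIntegral σ s|) (Ioi 0)

end DissipativeWave

end

open DissipativeWave

/-! On the Fourier side every frequency, with r = |ξ|, obeys y'' + r² y + b y' = 0. It suffices to
bound r² y² + y'² by exp(2κρ(r)) exp(-∫μ) times the data, uniformly in r and t
(`exists_mode_energy_le`); Plancherel then gives the energy estimate. Put g = ζ⁻¹ ∘ Θ and cut the
(t, r) plane along g(t) = r/N.

While g(t) ≤ r/N, the bound Ξ ≤ C g makes r dominate the oscillations of b. Let ψ = ir + a be an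
approximate solution of the Riccati equation ψ' + ψ² + bψ + r² = 0, corrected as often as m
derivatives of b allow. Then |y' - ψy|² / Im ψ decays like exp(-∫b) up to the exponential of a
multiple of ∫Ξ^(m+1) / r^m (`IsDerivSeq.exists_energy_le`). Since Θ / g^(m+1) = 1 / (g^m ρ(g)), the
last hypothesis bounds this loss by a multiple of ρ(r). Convergence of ∫σ lets μ replace b.

Beyond the boundary time τ no derivative of b is used. With S(t) = ∫_t^∞ σ, the substitution z =
exp(-S) y' removes σ from the damping and leaves factors exp(±S). These cost a multiple of r ∫_τ^∞
|S| ≤ r / Θ(τ) = r / ζ(r/N) = N ρ(r/N), again a multiple of ρ(r) (`IsStableDamping.energy_le`). This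
argument needs μ ≤ r, which holds once r(1+t) ≥ 1. For r(1+t) ≤ 1 a weighted estimate uses (1+t)μ ≤
μ₀ < 1 (`IsStableDamping.energy_le_of_mul_le_one`). Bounded times with bounded frequencies are left
to Gronwall.

The wave equation holds only weakly in x. After a cut-off to bounded frequencies, -Δ becomes a
bounded multiplier, the equation becomes an ordinary one in L², and uniqueness represents û(t, ξ)
through fundamental solutions of the mode equation (`IsSolution.ae_mode_le`). -/

namespace DissipativeWave

/-! ### Differential inequalities and single Fourier modes. -/

/-- A differential inequality `f' ≤ G' f` integrates to exponential growth at most. -/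
theorem le_mul_exp_of_hasDerivAt_le {f f' G g : ℝ → ℝ} {a b : ℝ} (hab : a ≤ b)
    (hf : ContinuousOn f (Icc a b)) (hG : ContinuousOn G (Icc a b))
    (hf' : ∀ t ∈ Ioo a b, HasDerivAt f (f' t) t) (hG' : ∀ t ∈ Ioo a b, HasDerivAt G (g t) t)
    (h : ∀ t ∈ Ioo a b, f' t ≤ g t * f t) : f b ≤ f a * Real.exp (G b - G a) := by
  have hanti : AntitoneOn (fun t => f t * Real.exp (-G t)) (Icc a b) := by
    refine antitoneOn_of_hasDerivWithinAt_nonpos (convex_Icc a b)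
      (hf.mul (Real.continuous_exp.comp_continuousOn hG.neg))
      (f' := fun t => f' t * Real.exp (-G t) + f t * (Real.exp (-G t) * -g t)) ?_ ?_
    · intro t ht
      rw [interior_Icc] at ht
      exact ((hf' t ht).mul (hG' t ht).neg.exp).hasDerivWithinAt
    · intro t ht
      rw [interior_Icc] at ht
      have := mul_le_mul_of_nonneg_right (h t ht) (Real.exp_pos (-G t)).le
      linarith
  have h1 := hanti (left_mem_Icc.2 hab) (right_mem_Icc.2 hab) hab
  have h2 := mul_le_mul_of_nonneg_right h1 (Real.exp_pos (G b)).le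
  simp only [mul_assoc, ← Real.exp_add] at h2
  simpa [sub_eq_add_neg, add_comm] using h2

/-- `y` solves `y'' + r² y + b y' = 0` on `[t₀, t₁]`, and `v = y'`. -/
structure IsModeOn (b : ℝ → ℝ) (r t₀ t₁ : ℝ) (y v : ℝ → ℝ) : Prop where
  continuousOn_fst : ContinuousOn y (Icc t₀ t₁)
  continuousOn_snd : ContinuousOn v (Icc t₀ t₁)
  hasDerivAt_fst : ∀ t ∈ Ioo t₀ t₁, HasDerivAt y (v t) t
  hasDerivAt_snd : ∀ t ∈ Ioo t₀ t₁, HasDerivAt v (-(r ^ 2 * y t) - b t * v t) t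

theorem IsModeOn.mono {b : ℝ → ℝ} {r t₀ t₁ s₀ s₁ : ℝ} {y v : ℝ → ℝ}
    (h : IsModeOn b r t₀ t₁ y v) (h₀ : t₀ ≤ s₀) (h₁ : s₁ ≤ t₁) : IsModeOn b r s₀ s₁ y v where
  continuousOn_fst := h.1.mono (Icc_subset_Icc h₀ h₁)
  continuousOn_snd := h.2.mono (Icc_subset_Icc h₀ h₁)
  hasDerivAt_fst t ht := h.3 t (Ioo_subset_Ioo h₀ h₁ ht)
  hasDerivAt_snd t ht := h.4 t (Ioo_subset_Ioo h₀ h₁ ht)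

/-- Crude Gronwall bound, without decay, for bounded times and frequencies. -/
theorem IsModeOn.sq_add_sq_le {b : ℝ → ℝ} {r t₀ t₁ R B : ℝ} {y v : ℝ → ℝ}
    (h : IsModeOn b r t₀ t₁ y v) (ht : t₀ ≤ t₁) (hr : 0 ≤ r) (hrR : r ≤ R)
    (hB : ∀ t ∈ Icc t₀ t₁, |b t| ≤ B) :
    y t₁ ^ 2 + v t₁ ^ 2 ≤
      (y t₀ ^ 2 + v t₀ ^ 2) * Real.exp ((1 + R ^ 2 + 2 * B) * (t₁ - t₀)) := by
  have key := le_mul_exp_of_hasDerivAt_le (f := fun t => y t ^ 2 + v t ^ 2)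
    (f' := fun t => 2 * y t * v t + 2 * v t * (-(r ^ 2 * y t) - b t * v t))
    (G := fun t => (1 + R ^ 2 + 2 * B) * t) (g := fun _ => 1 + R ^ 2 + 2 * B) ht
    ((h.1.pow 2).add (h.2.pow 2)) (by fun_prop) ?_ ?_ ?_
  · simpa [mul_sub] using key
  · intro t ht
    refine (((h.3 t ht).pow 2).add ((h.4 t ht).pow 2)).congr_deriv ?_
    simp
  · intro t ht
    simpa using (hasDerivAt_id t).const_mul (1 + R ^ 2 + 2 * B)
  · intro t ht
    have h1 := abs_le.1 (hB t (Ioo_subset_Icc_self ht))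
    have h2 : r ^ 2 ≤ R ^ 2 := by gcongr
    have h3 : 2 * y t * v t ≤ y t ^ 2 + v t ^ 2 := two_mul_le_add_sq _ _
    have h4 : -(2 * y t * v t) ≤ y t ^ 2 + v t ^ 2 := by nlinarith [sq_nonneg (y t + v t)]
    have h5 : r ^ 2 * -(2 * y t * v t) ≤ R ^ 2 * (y t ^ 2 + v t ^ 2) := by
      calc _ ≤ r ^ 2 * (y t ^ 2 + v t ^ 2) := by gcongr
        _ ≤ _ := by gcongr
    have h6 : 0 ≤ (B + b t) * v t ^ 2 := mul_nonneg (by linarith) (sq_nonneg _)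
    have h7 : 0 ≤ B * y t ^ 2 := mul_nonneg (by linarith) (sq_nonneg _)
    linarith

/-! ### Decay after the zone boundary, where σ enters only through its tail integral. -/

/-- Damping `b = μ + σ` for times `t ≥ T`, with `M' = μ` and `S' = -σ`. -/
structure IsStableDamping (b μ μ' M S : ℝ → ℝ) (T μ₀ K : ℝ) : Prop where
  nonneg : 0 ≤ T
  lt_one : μ₀ < 1
  one_le : 1 ≤ K
  continuousOn_μ : ContinuousOn μ (Ici T)
  continuousOn_M : ContinuousOn M (Ici T)
  continuousOn_S : ContinuousOn S (Ici T)
  hasDerivAt_μ : ∀ t, T < t → HasDerivAt μ (μ' t) t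
  hasDerivAt_M : ∀ t, T < t → HasDerivAt M (μ t) t
  hasDerivAt_S : ∀ t, T < t → HasDerivAt S (-(b t - μ t)) t
  pos : ∀ t, T ≤ t → 0 < μ t
  deriv_nonpos : ∀ t, T < t → μ' t ≤ 0
  mul_le : ∀ t, T ≤ t → (1 + t) * μ t ≤ μ₀
  exp_le : ∀ t, T ≤ t → Real.exp |S t| ≤ K

namespace IsStableDamping

variable {b μ μ' M S : ℝ → ℝ} {T μ₀ K : ℝ}

theorem monotone_M (h : IsStableDamping b μ μ' M S T μ₀ K) : MonotoneOn M (Ici T) := by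
  refine monotoneOn_of_hasDerivWithinAt_nonneg (convex_Ici T) h.continuousOn_M (f' := μ) ?_ ?_
  · intro t ht
    rw [interior_Ici] at ht
    exact (h.hasDerivAt_M t ht).hasDerivWithinAt
  · intro t ht
    rw [interior_Ici] at ht
    exact (h.pos t ht.le).le

theorem exp_S_le (h : IsStableDamping b μ μ' M S T μ₀ K) {t : ℝ} (ht : T ≤ t) :
    Real.exp (S t) ≤ K ∧ Real.exp (-S t) ≤ K :=
  ⟨(Real.exp_le_exp.2 (le_abs_self _)).trans (h.exp_le t ht),
    (Real.exp_le_exp.2 (neg_le_abs _)).trans (h.exp_le t ht)⟩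

theorem abs_exp_sub_one_le (x : ℝ) : |Real.exp x - 1| ≤ Real.exp |x| * |x| := by
  have h1 := Real.add_one_le_exp x
  have h2 := Real.add_one_le_exp (-x)
  have h3 : Real.exp x * Real.exp (-x) = 1 := by rw [← Real.exp_add]; simp
  rcases le_total 0 x with hx | hx
  · rw [abs_of_nonneg hx, abs_of_nonneg (by linarith)]
    nlinarith [Real.exp_pos x]
  · have h4 : 1 ≤ Real.exp |x| := Real.one_le_exp (abs_nonneg x)
    have h5 : Real.exp x ≤ 1 := Real.exp_le_one_iff.2 hx
    rw [abs_of_nonpos (by linarith : Real.exp x - 1 ≤ 0)]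
    have : |x| = -x := abs_of_nonpos hx
    nlinarith [abs_nonneg x]

theorem le_of_one_le (h : IsStableDamping b μ μ' M S T μ₀ K) {r t₀ t : ℝ} (hr : 0 < r)
    (hT : T ≤ t₀) (ht : t₀ ≤ t) (h1 : 1 ≤ r * (1 + t₀)) : μ t ≤ r := by
  have h2 := h.mul_le t (hT.trans ht)
  have h3 := h.lt_one
  have h4 := h.pos t (hT.trans ht)
  have h5 := h.nonneg
  have h6 : 1 ≤ r * (1 + t) := h1.trans (by gcongr)
  by_contra! hlt
  have : r * (1 + t) < (1 + t) * μ t := by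
    rw [mul_comm]; exact mul_lt_mul_of_pos_left hlt (by linarith)
  linarith

/-- The plain energy dissipates only -μz². The cross term μyz/2 in Q transfers half of this to r²y²,
and for p = q = 1 the μ-terms sum to exactly -μQ. The deviations of p and q from 1 cost 3rκ times
the plain energy, hence 6rκQ. The term with μ' is absorbed by -μ'/r ≥ 0, which has a bounded
primitive when μ ≤ r. -/
theorem deriv_corrected_energy_le {r y z μ μ' p q Q κ : ℝ} (hr : 0 < r) (hμ : 0 ≤ μ) (hμr : μ ≤ r)
    (hμ' : μ' ≤ 0) (hp : |p - 1| ≤ κ) (hq : |q - 1| ≤ κ)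
    (hQ : Q = (r ^ 2 * y ^ 2 + z ^ 2) / 2 + μ / 2 * (y * z))
    (hE : (r ^ 2 * y ^ 2 + z ^ 2) / 2 ≤ 2 * Q) :
    (r ^ 2 * (2 * y * (p * z)) + 2 * z * (-μ * z - r ^ 2 * q * y)) / 2 + (μ' / 2 * (y * z) +
      μ / 2 * (p * z * z + y * (-μ * z - r ^ 2 * q * y))) ≤ (-μ + 6 * r * κ - μ' / r) * Q := by
  have hκ : 0 ≤ κ := (abs_nonneg _).trans hp
  obtain ⟨E, hEdef⟩ : ∃ E, E = (r ^ 2 * y ^ 2 + z ^ 2) / 2 := ⟨_, rfl⟩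
  have hE0 : 0 ≤ E := by rw [hEdef]; positivity
  rw [← hEdef] at hE
  have hyz : |r * (y * z)| ≤ E := by
    have := two_mul_le_add_sq |r * y| |z|
    rw [sq_abs, sq_abs] at this
    rw [← mul_assoc, abs_mul, hEdef]
    linarith [mul_pow r y 2]
  have hpq : |p - q| ≤ 2 * κ := by
    calc |p - q| = |(p - 1) - (q - 1)| := by ring_nf
      _ ≤ |p - 1| + |q - 1| := abs_sub _ _
      _ ≤ 2 * κ := by linarith
  have c1 : r * ((p - q) * (r * (y * z))) ≤ r * (2 * κ) * E := by
    calc _ ≤ |r * ((p - q) * (r * (y * z)))| := le_abs_self _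
      _ = r * |p - q| * |r * (y * z)| := by rw [abs_mul, abs_mul, abs_of_pos hr]; ring
      _ ≤ _ := by gcongr
  have c2 : μ / 2 * ((p - 1) * z ^ 2 - (q - 1) * (r ^ 2 * y ^ 2)) ≤ r * κ * E := by
    have d1 : (p - 1) * z ^ 2 ≤ κ * z ^ 2 := by gcongr; exact (le_abs_self _).trans hp
    have d2 : -(q - 1) * (r ^ 2 * y ^ 2) ≤ κ * (r ^ 2 * y ^ 2) := by
      gcongr; exact (neg_le_abs _).trans hq
    calc _ ≤ μ / 2 * (κ * (2 * E)) := by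
          gcongr
          rw [hEdef]; linarith
      _ = μ * κ * E := by ring
      _ ≤ _ := by gcongr
  have hW : 0 ≤ -μ' / (2 * r) := div_nonneg (by linarith) (by positivity)
  have c3 : μ' / 2 * (y * z) ≤ -μ' / (2 * r) * E := by
    calc μ' / 2 * (y * z) = -μ' / (2 * r) * -(r * (y * z)) := by field_simp
      _ ≤ _ := by
        gcongr
        exact (neg_le_abs _).trans hyz
  have c4 : (r * (2 * κ) + r * κ + -μ' / (2 * r)) * E ≤
      (r * (2 * κ) + r * κ + -μ' / (2 * r)) * (2 * Q) := by gcongr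
  have e1 : (r ^ 2 * (2 * y * (p * z)) + 2 * z * (-μ * z - r ^ 2 * q * y)) / 2 +
      (μ' / 2 * (y * z) + μ / 2 * (p * z * z + y * (-μ * z - r ^ 2 * q * y))) = -μ * Q +
      (r * ((p - q) * (r * (y * z))) + μ / 2 * ((p - 1) * z ^ 2 -
        (q - 1) * (r ^ 2 * y ^ 2)) + μ' / 2 * (y * z)) := by
    rw [hQ]; ring
  have e2 : (-μ + 6 * r * κ - μ' / r) * Q =
      -μ * Q + (r * (2 * κ) + r * κ + -μ' / (2 * r)) * (2 * Q) := by field_simp; ring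
  rw [e1, e2]
  linarith

/-- Energy decay once `r (1 + t) ≥ 1`. -/
theorem energy_le (h : IsStableDamping b μ μ' M S T μ₀ K) {J : ℝ → ℝ} {r t₀ t₁ : ℝ} {y v : ℝ → ℝ}
    (hm : IsModeOn b r t₀ t₁ y v) (hr : 0 < r) (hT : T ≤ t₀) (ht : t₀ ≤ t₁)
    (h1 : 1 ≤ r * (1 + t₀)) (hJ : ContinuousOn J (Icc t₀ t₁))
    (hJ' : ∀ t ∈ Ioo t₀ t₁, HasDerivAt J |S t| t) :
    r ^ 2 * y t₁ ^ 2 + v t₁ ^ 2 ≤ 3 * K ^ 4 * Real.exp 1 *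
      Real.exp (6 * K * (r * (J t₁ - J t₀))) * Real.exp (-(M t₁ - M t₀)) *
      (r ^ 2 * y t₀ ^ 2 + v t₀ ^ 2) := by
  have hK := h.one_le
  have hIcc : ∀ t ∈ Icc t₀ t₁, T ≤ t := fun t h => hT.trans h.1
  have hIoo : ∀ t ∈ Ioo t₀ t₁, T < t := fun t h => hT.trans_lt h.1
  -- As S' = -σ, the factor exp(-S) cancels σ and leaves μ as the only damping of z.
  set z : ℝ → ℝ := fun t => Real.exp (-S t) * v t with hz
  have hsub : Icc t₀ t₁ ⊆ Ici T := hIcc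
  have hzc : ContinuousOn z (Icc t₀ t₁) :=
    (Real.continuous_exp.comp_continuousOn (h.continuousOn_S.mono hsub).neg).mul hm.2
  have hvz : ∀ t, v t = Real.exp (S t) * z t := fun t => by
    simp only [hz, ← mul_assoc, ← Real.exp_add]; simp
  have hz' : ∀ t ∈ Ioo t₀ t₁,
      HasDerivAt z (-μ t * z t - r ^ 2 * Real.exp (-S t) * y t) t := fun t ht => by
    refine (((h.hasDerivAt_S t (hIoo t ht)).neg.exp).mul (hm.4 t ht)).congr_deriv ?_
    simp only [hz, Pi.neg_apply]; ring
  set Q : ℝ → ℝ := fun t => (r ^ 2 * y t ^ 2 + z t ^ 2) / 2 + μ t / 2 * (y t * z t) with hQ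
  have hQE : ∀ t ∈ Icc t₀ t₁, (r ^ 2 * y t ^ 2 + z t ^ 2) / 2 ≤ 2 * Q t ∧
      2 * Q t ≤ 3 * ((r ^ 2 * y t ^ 2 + z t ^ 2) / 2) := fun t ht => by
    have h2 := h.le_of_one_le hr hT ht.1 h1
    have h3 := h.pos t (hIcc t ht)
    have h4 : μ t * |y t * z t| ≤ (r ^ 2 * y t ^ 2 + z t ^ 2) / 2 := by
      calc μ t * |y t * z t| ≤ r * |y t * z t| := by gcongr
        _ = |r * y t| * |z t| := by rw [abs_mul, abs_mul r, abs_of_pos hr]; ring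
        _ ≤ _ := by
          have := two_mul_le_add_sq |r * y t| |z t|
          rw [sq_abs, sq_abs] at this
          linarith [mul_pow r (y t) 2]
    have h5 := abs_le.1 (show |μ t * (y t * z t)| ≤ (r ^ 2 * y t ^ 2 + z t ^ 2) / 2 by
      rwa [abs_mul, abs_of_pos h3])
    constructor <;> simp only [hQ] <;> linarith
  -- The term -μ/r of G accounts for the error in μ'. It increases by at most μ(t₀)/r ≤ 1, whence
  -- the factor exp 1.
  have key := le_mul_exp_of_hasDerivAt_le (f := Q) (G := fun t => -M t + 6 * K * r * J t - μ t / r)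
    (f' := fun t => (r ^ 2 * (2 * y t * v t) + 2 * z t *
      (-μ t * z t - r ^ 2 * Real.exp (-S t) * y t)) / 2 + (μ' t / 2 * (y t * z t) + μ t / 2 *
      (v t * z t + y t * (-μ t * z t - r ^ 2 * Real.exp (-S t) * y t))))
    (g := fun t => -μ t + 6 * K * r * |S t| - μ' t / r) ht ?_ ?_ ?_ ?_ ?_
  · have e1 := hQE t₁ ⟨ht, le_rfl⟩
    have e0 := hQE t₀ ⟨le_rfl, ht⟩
    have g1 : -M t₁ + 6 * K * r * J t₁ - μ t₁ / r -
        (-M t₀ + 6 * K * r * J t₀ - μ t₀ / r) ≤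
        1 + 6 * K * (r * (J t₁ - J t₀)) + -(M t₁ - M t₀) := by
      have a1 : 0 ≤ μ t₁ / r := (div_pos (h.pos t₁ (hT.trans ht)) hr).le
      have a2 : μ t₀ / r ≤ 1 := (div_le_one hr).2 (h.le_of_one_le hr hT le_rfl h1)
      linarith
    have g2 := Real.exp_le_exp.2 g1
    rw [Real.exp_add, Real.exp_add] at g2
    have g0 : 0 ≤ Q t₀ := by
      have : 0 ≤ (r ^ 2 * y t₀ ^ 2 + z t₀ ^ 2) / 2 := by positivity
      linarith
    have g3 := key.trans (mul_le_mul_of_nonneg_left g2 g0)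
    have hS1 := (h.exp_S_le (hT.trans ht)).1
    have hS0 := (h.exp_S_le hT).2
    have b1 : r ^ 2 * y t₁ ^ 2 + v t₁ ^ 2 ≤ K ^ 2 * (r ^ 2 * y t₁ ^ 2 + z t₁ ^ 2) := by
      have c1 : v t₁ ^ 2 ≤ K ^ 2 * z t₁ ^ 2 := by
        rw [hvz t₁, mul_pow]; gcongr
      have c2 : 1 ≤ K ^ 2 := one_le_pow₀ hK
      nlinarith [mul_nonneg (sq_nonneg r) (sq_nonneg (y t₁))]
    have b0 : r ^ 2 * y t₀ ^ 2 + z t₀ ^ 2 ≤ K ^ 2 * (r ^ 2 * y t₀ ^ 2 + v t₀ ^ 2) := by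
      have c1 : z t₀ ^ 2 ≤ K ^ 2 * v t₀ ^ 2 := by
        rw [hz]; simp only [mul_pow]; gcongr
      have c2 : 1 ≤ K ^ 2 := one_le_pow₀ hK
      nlinarith [mul_nonneg (sq_nonneg r) (sq_nonneg (y t₀))]
    calc r ^ 2 * y t₁ ^ 2 + v t₁ ^ 2 ≤ K ^ 2 * (4 * Q t₁) := b1.trans (by gcongr; linarith)
      _ ≤ K ^ 2 * (4 * (Q t₀ * (Real.exp 1 * Real.exp (6 * K * (r * (J t₁ - J t₀))) *
          Real.exp (-(M t₁ - M t₀))))) := by gcongr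
      _ ≤ K ^ 2 * (4 * ((3 * (K ^ 2 * (r ^ 2 * y t₀ ^ 2 + v t₀ ^ 2)) / 4) *
          (Real.exp 1 * Real.exp (6 * K * (r * (J t₁ - J t₀))) *
          Real.exp (-(M t₁ - M t₀))))) := by gcongr; linarith
      _ = _ := by ring
  · exact ((((hm.1.pow 2).const_mul _).add (hzc.pow 2)).div_const 2).add
      (((h.continuousOn_μ.mono hsub).div_const 2).mul (hm.1.mul hzc))
  · have hM := h.continuousOn_M.mono hsub
    have hμ := h.continuousOn_μ.mono hsub
    fun_prop (disch := assumption)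
  · intro t ht
    have e1 := (((hm.3 t ht).pow 2).const_mul (r ^ 2)).add ((hz' t ht).pow 2)
    have e2 := ((h.hasDerivAt_μ t (hIoo t ht)).div_const 2).mul ((hm.3 t ht).mul (hz' t ht))
    refine ((e1.div_const 2).add e2).congr_deriv ?_
    simp
  · intro t ht
    refine (((h.hasDerivAt_M t (hIoo t ht)).neg.add ((hJ' t ht).const_mul (6 * K * r))).sub
      ((h.hasDerivAt_μ t (hIoo t ht)).div_const r)).congr_deriv ?_
    simp
  · intro t ht
    have ht' := Ioo_subset_Icc_self ht
    have htT := hIcc t ht'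
    have hp := (abs_exp_sub_one_le (S t)).trans
      (mul_le_mul_of_nonneg_right (h.exp_le t htT) (abs_nonneg _))
    have hq := (abs_exp_sub_one_le (-S t)).trans
      (mul_le_mul_of_nonneg_right ((abs_neg (S t)).symm ▸ h.exp_le t htT) (abs_nonneg _))
    rw [abs_neg] at hq
    have := deriv_corrected_energy_le hr (h.pos t htT).le (h.le_of_one_le hr hT ht'.1 h1)
      (h.deriv_nonpos t (hIoo t ht)) hp hq (y := y t) (z := z t) (Q := Q t) rfl (hQE t ht').1
    rw [← hvz t] at this
    exact this.trans_eq (by ring)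

/-- This is where (1+t)μ < 1 enters: exp(-M) decays no faster than a multiple of 1/(1+t). It keeps
the weight `q` of the low-frequency estimate at most 1. -/
theorem monotoneOn_one_add_mul_exp (h : IsStableDamping b μ μ' M S T μ₀ K) :
    MonotoneOn (fun t => (1 + t) * Real.exp (-M t)) (Ici T) := by
  refine monotoneOn_of_hasDerivWithinAt_nonneg (convex_Ici T)
    ((by fun_prop : ContinuousOn (fun t : ℝ => 1 + t) (Ici T)).mul
      (Real.continuous_exp.comp_continuousOn h.continuousOn_M.neg))
    (f' := fun t => Real.exp (-M t) * (1 - (1 + t) * μ t)) ?_ ?_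
  · intro t ht
    rw [interior_Ici] at ht
    refine ((((hasDerivAt_id t).const_add 1).mul
      (h.hasDerivAt_M t ht).neg.exp).congr_deriv ?_).hasDerivWithinAt
    simp; ring
  · intro t ht
    rw [interior_Ici] at ht
    have := h.mul_le t (le_of_lt ht)
    have := h.lt_one
    exact mul_nonneg (Real.exp_pos _).le (by linarith)

/-- The system is y' = e A x, x' = -r² A⁻¹ e' y. Weighting y by a constant q gives growth rates
proportional to qA and r²/(A₁q); q is chosen later so that both have bounded integrals. -/
theorem deriv_weighted_energy_le {r A A₁ e e' q K x y : ℝ} (hA₁ : 0 < A₁) (hA : A₁ ≤ A)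
    (he : 0 < e) (he' : 0 < e') (heK : e ≤ K) (heK' : e' ≤ K) (hq : 0 < q) :
    2 * x * (-(r ^ 2 * A⁻¹ * e' * y)) + q ^ 2 * (2 * y * (e * A * x)) ≤
      (q * K * A + r ^ 2 * K * A₁⁻¹ * q⁻¹) * (x ^ 2 + q ^ 2 * y ^ 2) := by
  have hA0 : 0 < A := hA₁.trans_le hA
  have h1 : 2 * q * (x * y) ≤ x ^ 2 + q ^ 2 * y ^ 2 := by nlinarith [sq_nonneg (x - q * y)]
  have h2 : -(2 * q * (x * y)) ≤ x ^ 2 + q ^ 2 * y ^ 2 := by nlinarith [sq_nonneg (x + q * y)]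
  have h3 : A⁻¹ ≤ A₁⁻¹ := by gcongr
  have hK : 0 ≤ K := he.le.trans heK
  calc _ = (r ^ 2 * e' * A⁻¹ * q⁻¹) * -(2 * q * (x * y)) + (q * e * A) * (2 * q * (x * y)) := by
        field_simp
    _ ≤ (r ^ 2 * e' * A⁻¹ * q⁻¹) * (x ^ 2 + q ^ 2 * y ^ 2) +
        (q * e * A) * (x ^ 2 + q ^ 2 * y ^ 2) := by gcongr
    _ ≤ (r ^ 2 * K * A₁⁻¹ * q⁻¹) * (x ^ 2 + q ^ 2 * y ^ 2) +
        (q * K * A) * (x ^ 2 + q ^ 2 * y ^ 2) := by gcongr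
    _ = _ := by ring

set_option maxHeartbeats 1000000 in
/-- Energy decay as long as `r (1 + t) ≤ 1`. -/
theorem energy_le_of_mul_le_one (h : IsStableDamping b μ μ' M S T μ₀ K) {r t₀ t₁ : ℝ}
    {y v : ℝ → ℝ} (hm : IsModeOn b r t₀ t₁ y v) (hr : 0 ≤ r) (hT : T ≤ t₀) (ht : t₀ ≤ t₁)
    (h1 : r * (1 + t₁) ≤ 1) :
    r ^ 2 * y t₁ ^ 2 + v t₁ ^ 2 ≤ 2 * K ^ 4 * Real.exp (K / (1 - μ₀) + K) *
      Real.exp (-(M t₁ - M t₀)) * (y t₀ ^ 2 + v t₀ ^ 2) := by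
  have hK := h.one_le
  have hT0 := h.nonneg
  have hμ₀ : 0 < 1 - μ₀ := by linarith [h.lt_one]
  have hIcc : ∀ t ∈ Icc t₀ t₁, T ≤ t := fun t h => hT.trans h.1
  have hIoo : ∀ t ∈ Ioo t₀ t₁, T < t := fun t h => hT.trans_lt h.1
  have hsub : Icc t₀ t₁ ⊆ Ici T := hIcc
  have hMc := h.continuousOn_M.mono hsub
  have ht₀ : (0 : ℝ) < 1 + t₀ := by linarith
  have ht₁ : (0 : ℝ) < 1 + t₁ := by linarith
  set A : ℝ → ℝ := fun t => Real.exp (-(M t - M t₀)) with hA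
  have hA0 : ∀ t, 0 < A t := fun t => Real.exp_pos _
  have hAanti : ∀ t ∈ Icc t₀ t₁, A t₁ ≤ A t := fun t ht => by
    have := h.monotone_M (hIcc t ht) (hT.trans (ht.1.trans ht.2)) ht.2
    exact Real.exp_le_exp.2 (by linarith)
  have hA1 : A t₁ ≤ 1 := by
    have := hAanti t₀ ⟨le_rfl, ht⟩
    simpa [hA] using this
  -- Dividing v by its expected decay `A` and by exp(S) removes the whole damping, so only the term
  -- r²y drives x.
  set x : ℝ → ℝ := fun t => Real.exp (-S t) * (A t)⁻¹ * v t with hx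
  have hAinv : ∀ t, (A t)⁻¹ = Real.exp (M t - M t₀) := fun t => by
    simp only [hA, ← Real.exp_neg, neg_neg]
  have hvx : ∀ t, v t = Real.exp (S t) * A t * x t := fun t => by
    have := (hA0 t).ne'
    simp only [hx]
    calc v t = (Real.exp (S t) * Real.exp (-S t)) * (A t * (A t)⁻¹) * v t := by
          rw [← Real.exp_add, mul_inv_cancel₀ this]; simp
      _ = _ := by ring
  have hxc : ContinuousOn x (Icc t₀ t₁) := by
    have hSc := h.continuousOn_S.mono hsub
    have hvc := hm.2
    simp only [hx, hAinv]
    fun_prop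
  have hx' : ∀ t ∈ Ioo t₀ t₁, HasDerivAt x (-(r ^ 2 * (A t)⁻¹ * Real.exp (-S t) * y t)) t := by
    intro t ht
    simp only [hx, hAinv]
    refine ((((h.hasDerivAt_S t (hIoo t ht)).neg.exp).mul
      ((h.hasDerivAt_M t (hIoo t ht)).sub_const (M t₀)).exp).mul (hm.4 t ht)).congr_deriv ?_
    simp only [Pi.neg_apply, Pi.mul_apply]
    ring
  -- For nearly constant x, y grows like ∫A, which is at most a multiple of (1+t)A; `q` normalizes
  -- that growth at the final time.
  set q : ℝ := ((1 + t₁) * A t₁)⁻¹ with hq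
  have hq0 : 0 < q := inv_pos.2 (mul_pos ht₁ (hA0 _))
  have hq1 : q ≤ 1 := by
    have hmono := h.monotoneOn_one_add_mul_exp hT (hT.trans ht) ht
    have : (1 + t₁) * A t₁ ≥ 1 + t₀ := by
      have e : ∀ t, A t = Real.exp (-M t) * Real.exp (M t₀) := fun t => by
        simp only [hA, ← Real.exp_add]; ring_nf
      calc 1 + t₀ = (1 + t₀) * Real.exp (-M t₀) * Real.exp (M t₀) := by
            rw [mul_assoc, ← Real.exp_add]; simp
        _ ≤ (1 + t₁) * Real.exp (-M t₁) * Real.exp (M t₀) := by gcongr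
        _ = _ := by rw [e]; ring
    exact inv_le_one_of_one_le₀ (by linarith)
  have key := le_mul_exp_of_hasDerivAt_le (f := fun t => x t ^ 2 + q ^ 2 * y t ^ 2)
    (G := fun t => q * K / (1 - μ₀) * ((1 + t) * A t) + r ^ 2 * K * (A t₁)⁻¹ * q⁻¹ * t)
    (f' := fun t => 2 * x t * (-(r ^ 2 * (A t)⁻¹ * Real.exp (-S t) * y t)) +
      q ^ 2 * (2 * y t * v t))
    (g := fun t => q * K / (1 - μ₀) * (A t * (1 - (1 + t) * μ t)) + r ^ 2 * K * (A t₁)⁻¹ * q⁻¹)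
    ht ((hxc.pow 2).add ((hm.1.pow 2).const_mul _)) (by simp only [hA]; fun_prop) ?_ ?_ ?_
  · have hG : q * K / (1 - μ₀) * ((1 + t₁) * A t₁) + r ^ 2 * K * (A t₁)⁻¹ * q⁻¹ * t₁ -
        (q * K / (1 - μ₀) * ((1 + t₀) * A t₀) + r ^ 2 * K * (A t₁)⁻¹ * q⁻¹ * t₀) ≤
        K / (1 - μ₀) + K := by
      have a1 : q * K / (1 - μ₀) * ((1 + t₁) * A t₁) = K / (1 - μ₀) := by
        have := (hA0 t₁).ne'
        simp only [hq]; field_simp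
      have a2 : 0 ≤ q * K / (1 - μ₀) * ((1 + t₀) * A t₀) := by
        have := hA0 t₀
        positivity
      have a3 : r ^ 2 * K * (A t₁)⁻¹ * q⁻¹ = K * (r * (r * (1 + t₁))) := by
        have := (hA0 t₁).ne'
        simp only [hq]; field_simp
      have a4 : r * (r * (1 + t₁)) * (t₁ - t₀) ≤ 1 := by
        calc _ ≤ r * 1 * (1 + t₁) := by gcongr; linarith
          _ ≤ 1 := by linarith
      rw [a1, a3]
      have := mul_le_mul_of_nonneg_left a4 (by linarith : 0 ≤ K)
      linarith
    have g0 : 0 ≤ x t₀ ^ 2 + q ^ 2 * y t₀ ^ 2 := by positivity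
    have g1 := key.trans (mul_le_mul_of_nonneg_left (Real.exp_le_exp.2 hG) g0)
    have hS1 := (h.exp_S_le (hT.trans ht)).1
    have hS0 := (h.exp_S_le hT).2
    have K2 : 1 ≤ K ^ 2 := one_le_pow₀ hK
    have b0 : x t₀ ^ 2 + q ^ 2 * y t₀ ^ 2 ≤ K ^ 2 * (y t₀ ^ 2 + v t₀ ^ 2) := by
      have c1 : x t₀ ^ 2 ≤ K ^ 2 * v t₀ ^ 2 := by
        have : x t₀ = Real.exp (-S t₀) * v t₀ := by simp [hx, hA]
        rw [this, mul_pow]; gcongr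
      have c2 : q ^ 2 ≤ K ^ 2 := by gcongr; linarith
      nlinarith [mul_le_mul_of_nonneg_right c2 (sq_nonneg (y t₀))]
    have b1 : r ^ 2 * y t₁ ^ 2 + v t₁ ^ 2 ≤ 2 * K ^ 2 * A t₁ * (x t₁ ^ 2 + q ^ 2 * y t₁ ^ 2) := by
      have d0 : A t₁ ^ 2 ≤ A t₁ := by nlinarith [hA0 t₁]
      have c1 : v t₁ ^ 2 ≤ K ^ 2 * A t₁ * x t₁ ^ 2 := by
        rw [hvx t₁, mul_pow, mul_pow]; gcongr
      -- From r(1+t₁) ≤ 1 one gets r²/q² ≤ A(t₁)², and A(t₁) ≤ 1. Only one power of A is needed.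
      have c2 : r ^ 2 ≤ K ^ 2 * A t₁ * q ^ 2 := by
        have e1 : r ^ 2 * ((1 + t₁) * A t₁) ^ 2 ≤ A t₁ := by
          calc _ = (r * (1 + t₁)) ^ 2 * A t₁ ^ 2 := by ring
            _ ≤ 1 * A t₁ ^ 2 := by
              gcongr
              exact pow_le_one₀ (by positivity) h1
            _ ≤ _ := by linarith
        have e2 : r ^ 2 ≤ A t₁ * q ^ 2 := by
          rw [hq, inv_pow, ← div_eq_mul_inv, le_div_iff₀ (pow_pos (mul_pos ht₁ (hA0 _)) 2)]
          exact e1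
        have := mul_nonneg (hA0 t₁).le (sq_nonneg q)
        nlinarith
      have c3 := mul_le_mul_of_nonneg_right c2 (sq_nonneg (y t₁))
      have c4 : 0 ≤ K ^ 2 * A t₁ * x t₁ ^ 2 := by have := hA0 t₁; positivity
      have c5 : 0 ≤ K ^ 2 * A t₁ * (q ^ 2 * y t₁ ^ 2) := by have := hA0 t₁; positivity
      linarith
    have := hA0 t₁
    calc _ ≤ 2 * K ^ 2 * A t₁ * ((x t₀ ^ 2 + q ^ 2 * y t₀ ^ 2) * Real.exp (K / (1 - μ₀) + K)) :=
          b1.trans (by gcongr)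
      _ ≤ 2 * K ^ 2 * A t₁ * (K ^ 2 * (y t₀ ^ 2 + v t₀ ^ 2) * Real.exp (K / (1 - μ₀) + K)) := by
          gcongr
      _ = _ := by ring
  · intro t ht
    refine (((hx' t ht).pow 2).add (((hm.3 t ht).pow 2).const_mul (q ^ 2))).congr_deriv ?_
    simp
  · intro t ht
    have hA' : HasDerivAt A (A t * -μ t) t :=
      ((h.hasDerivAt_M t (hIoo t ht)).sub_const (M t₀)).neg.exp
    refine (((((hasDerivAt_id t).const_add 1).mul hA').const_mul (q * K / (1 - μ₀))).add
      ((hasDerivAt_id t).const_mul (r ^ 2 * K * (A t₁)⁻¹ * q⁻¹))).congr_deriv ?_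
    simp only [id_eq]; ring
  · intro t ht
    have ht' := Ioo_subset_Icc_self ht
    have hS := h.exp_S_le (hIcc t ht')
    have e1 := deriv_weighted_energy_le (r := r) (x := x t) (y := y t) (hA0 t₁) (hAanti t ht')
      (Real.exp_pos (S t)) (Real.exp_pos (-S t)) hS.1 hS.2 hq0
    rw [← hvx t] at e1
    refine e1.trans ?_
    -- Since (1+t)μ ≤ μ₀ < 1, the derivative A(1 - (1+t)μ) of (1+t)A dominates (1-μ₀)A. This bounds
    -- ∫A.
    have e2 : A t ≤ (1 - μ₀)⁻¹ * (A t * (1 - (1 + t) * μ t)) := by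
      rw [← div_eq_inv_mul, le_div_iff₀ hμ₀]
      have := h.mul_le t (hIcc t ht')
      have := hA0 t
      gcongr
    have e3 : q * K * A t ≤ q * K / (1 - μ₀) * (A t * (1 - (1 + t) * μ t)) := by
      rw [div_eq_mul_inv, mul_assoc (q * K)]
      gcongr
    gcongr

end IsStableDamping

/-! ### Primitives on half-lines. -/

theorem intervalIntegrable_of_continuousOn_Ici {f : ℝ → ℝ} {a s t : ℝ} (hf : ContinuousOn f (Ici a))
    (hs : a ≤ s) (ht : a ≤ t) : IntervalIntegrable f volume s t :=
  (hf.mono fun _ hx => (le_min hs ht).trans hx.1).intervalIntegrable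

theorem hasDerivAt_integral_of_continuousOn_Ici {f : ℝ → ℝ} {a t : ℝ} (hf : ContinuousOn f (Ici a))
    (ht : a < t) : HasDerivAt (fun s => ∫ x in a..s, f x) (f t) t := by
  have hc : ContinuousAt f t := (hf t ht.le).continuousAt (Ici_mem_nhds ht)
  exact intervalIntegral.integral_hasDerivAt_right
    (intervalIntegrable_of_continuousOn_Ici hf le_rfl ht.le)
    ((hf.mono Ioi_subset_Ici_self).stronglyMeasurableAtFilter isOpen_Ioi t ht) hc

theorem continuousOn_integral_of_intervalIntegrable {f : ℝ → ℝ} {a : ℝ}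
    (hf : ∀ t, a ≤ t → IntervalIntegrable f volume a t) :
    ContinuousOn (fun s => ∫ x in a..s, f x) (Ici a) := by
  intro t ht
  have ht' : a ≤ t + 1 := le_trans ht (by linarith)
  have h := intervalIntegral.continuousOn_primitive_interval' (hf (t + 1) ht') left_mem_uIcc
  rw [uIcc_of_le ht'] at h
  refine (h t ⟨ht, by linarith⟩).mono_of_mem_nhdsWithin ?_
  rw [← Ici_inter_Iic]
  exact inter_mem self_mem_nhdsWithin (mem_nhdsWithin_of_mem_nhds (Iic_mem_nhds (by linarith)))

theorem continuousOn_integral_of_continuousOn_Ici {f : ℝ → ℝ} {a : ℝ}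
    (hf : ContinuousOn f (Ici a)) : ContinuousOn (fun s => ∫ x in a..s, f x) (Ici a) :=
  continuousOn_integral_of_intervalIntegrable fun _ ht =>
    intervalIntegrable_of_continuousOn_Ici hf le_rfl ht

/-! ### Symbols and approximate solutions of the Riccati equation. -/

/-- `B 0, …, B m` are the successive derivatives of `B 0` on `[0, ∞)`, and `B k = O(Ξ ^ (k + 1))`. -/
structure IsDerivSeq (m : ℕ) (B : ℕ → ℝ → ℝ) (Ξ : ℝ → ℝ) : Prop where
  pos : ∀ t, 0 ≤ t → 0 < Ξ t
  continuousOn : ∀ k ≤ m, ContinuousOn (B k) (Ici 0)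
  hasDerivAt : ∀ k < m, ∀ t, 0 < t → HasDerivAt (B k) (B (k + 1) t) t
  abs_apply_le : ∀ k ≤ m, ∀ t, 0 ≤ t → |B k t| ≤ Ξ t ^ (k + 1)

/-- Polynomials in a parameter `ε` and in `B 0, …, B l` that are isobaric of weight `w`, where `B k`
has weight `k + 1` and `ε` has weight `-1`. -/
inductive IsSymbol (B : ℕ → ℝ → ℝ) : ℕ → ℕ → (ℂ → ℝ → ℂ) → Prop
  | base (k : ℕ) : IsSymbol B (k + 1) k fun _ t => (B k t : ℂ)
  | add {w l : ℕ} {f g : ℂ → ℝ → ℂ} : IsSymbol B w l f → IsSymbol B w l g →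
      IsSymbol B w l fun ε t => f ε t + g ε t
  | mul {w w' l : ℕ} {f g : ℂ → ℝ → ℂ} : IsSymbol B w l f → IsSymbol B w' l g →
      IsSymbol B (w + w') l fun ε t => f ε t * g ε t
  | const_mul {w l : ℕ} {f : ℂ → ℝ → ℂ} (c : ℂ) : IsSymbol B w l f →
      IsSymbol B w l fun ε t => c * f ε t
  | param_mul {w l : ℕ} {f : ℂ → ℝ → ℂ} : IsSymbol B (w + 1) l f →
      IsSymbol B w l fun ε t => ε * f ε t
  | mono {w l l' : ℕ} {f : ℂ → ℝ → ℂ} : l ≤ l' → IsSymbol B w l f → IsSymbol B w l' f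

namespace IsSymbol

variable {m : ℕ} {B : ℕ → ℝ → ℝ} {Ξ : ℝ → ℝ} {w l : ℕ} {f : ℂ → ℝ → ℂ}

theorem param_pow_mul (j : ℕ) : ∀ {w : ℕ}, IsSymbol B (w + j) l f →
    IsSymbol B w l fun ε t => ε ^ j * f ε t := by
  induction j with
  | zero => intro w h; simpa using h
  | succ j ih =>
    intro w h
    have := (ih (w := w + 1) (by rwa [add_assoc, add_comm 1])).param_mul
    simpa only [pow_succ', mul_assoc] using this

/-- Weight counts powers of Ξ. A factor ε may count as weight -1 because ‖ε‖ ≤ 1/Ξ in the region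
considered. -/
theorem exists_norm_le (hB : IsDerivSeq m B Ξ) (h : IsSymbol B w l f) (hl : l ≤ m) :
    ∃ C : ℝ, 0 ≤ C ∧ ∀ ε t, 0 ≤ t → ‖ε‖ * Ξ t ≤ 1 → ‖f ε t‖ ≤ C * Ξ t ^ w := by
  induction h with
  | base k =>
    refine ⟨1, zero_le_one, fun ε t ht _ => ?_⟩
    simpa using hB.abs_apply_le k hl t ht
  | add _ _ ih₁ ih₂ =>
    obtain ⟨C₁, h₁, H₁⟩ := ih₁ hl
    obtain ⟨C₂, h₂, H₂⟩ := ih₂ hl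
    refine ⟨C₁ + C₂, by positivity, fun ε t ht hε => (norm_add_le _ _).trans ?_⟩
    rw [add_mul]
    exact add_le_add (H₁ ε t ht hε) (H₂ ε t ht hε)
  | mul _ _ ih₁ ih₂ =>
    obtain ⟨C₁, h₁, H₁⟩ := ih₁ hl
    obtain ⟨C₂, h₂, H₂⟩ := ih₂ hl
    refine ⟨C₁ * C₂, by positivity, fun ε t ht hε => ?_⟩
    have hΞ := hB.pos t ht
    rw [norm_mul, pow_add, mul_mul_mul_comm]
    exact mul_le_mul (H₁ ε t ht hε) (H₂ ε t ht hε) (norm_nonneg _) (by positivity)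
  | const_mul c _ ih =>
    obtain ⟨C, h, H⟩ := ih hl
    refine ⟨‖c‖ * C, by positivity, fun ε t ht hε => ?_⟩
    rw [norm_mul, mul_assoc]
    exact mul_le_mul_of_nonneg_left (H ε t ht hε) (norm_nonneg _)
  | @param_mul w _ _ _ ih =>
    obtain ⟨C, h, H⟩ := ih hl
    refine ⟨C, h, fun ε t ht hε => ?_⟩
    have hΞ := hB.pos t ht
    calc _ = ‖ε‖ * _ := norm_mul _ _
      _ ≤ ‖ε‖ * (C * Ξ t ^ (w + 1)) := mul_le_mul_of_nonneg_left (H ε t ht hε) (norm_nonneg _)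
      _ = (‖ε‖ * Ξ t) * (C * Ξ t ^ w) := by ring
      _ ≤ 1 * (C * Ξ t ^ w) := by gcongr
      _ = _ := one_mul _
  | mono hll _ ih => exact ih (hll.trans hl)

theorem continuousOn (hB : IsDerivSeq m B Ξ) (h : IsSymbol B w l f) (hl : l ≤ m) (ε : ℂ) :
    ContinuousOn (f ε) (Ici 0) := by
  induction h with
  | base k => exact Complex.continuous_ofReal.comp_continuousOn (hB.continuousOn k hl)
  | add _ _ ih₁ ih₂ => exact (ih₁ hl).add (ih₂ hl)
  | mul _ _ ih₁ ih₂ => exact (ih₁ hl).mul (ih₂ hl)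
  | const_mul c _ ih => exact (ih hl).const_mul c
  | param_mul _ ih => exact (ih hl).const_mul ε
  | mono hll _ ih => exact ih (hll.trans hl)

theorem exists_hasDerivAt (hB : IsDerivSeq m B Ξ) (h : IsSymbol B w l f) (hl : l < m) :
    ∃ g, IsSymbol B (w + 1) (l + 1) g ∧ ∀ ε t, 0 < t → HasDerivAt (f ε) (g ε t) t := by
  induction h with
  | base k => exact ⟨_, .base (k + 1), fun ε t ht => (hB.hasDerivAt k hl t ht).ofReal_comp⟩
  | add _ _ ih₁ ih₂ =>
    obtain ⟨g₁, h₁, H₁⟩ := ih₁ hl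
    obtain ⟨g₂, h₂, H₂⟩ := ih₂ hl
    exact ⟨_, h₁.add h₂, fun ε t ht => (H₁ ε t ht).add (H₂ ε t ht)⟩
  | @mul w w' l f₁ f₂ hf₁ hf₂ ih₁ ih₂ =>
    obtain ⟨g₁, h₁, H₁⟩ := ih₁ hl
    obtain ⟨g₂, h₂, H₂⟩ := ih₂ hl
    have e₁ := h₁.mul (hf₂.mono (Nat.le_succ l))
    have e₂ := (hf₁.mono (Nat.le_succ l)).mul h₂
    rw [show w + 1 + w' = w + w' + 1 by ring] at e₁
    exact ⟨_, e₁.add e₂, fun ε t ht => (H₁ ε t ht).mul (H₂ ε t ht)⟩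
  | const_mul c _ ih =>
    obtain ⟨g, h, H⟩ := ih hl
    exact ⟨_, h.const_mul c, fun ε t ht => (H ε t ht).const_mul c⟩
  | param_mul _ ih =>
    obtain ⟨g, h, H⟩ := ih hl
    exact ⟨_, h.param_mul, fun ε t ht => (H ε t ht).const_mul ε⟩
  | mono hll _ ih =>
    obtain ⟨g, h, H⟩ := ih (hll.trans_lt hl)
    exact ⟨g, h.mono (Nat.succ_le_succ hll), H⟩

/-- Approximate solutions of the Riccati equation `a' + a² + (ε⁻¹ + B₀) a + B₀ / (2ε) = 0`. -/
theorem exists_riccati (hB : IsDerivSeq m B Ξ) (j : ℕ) (hj : j < m) :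
    ∃ a a' R : ℂ → ℝ → ℂ, IsSymbol B 1 j a ∧ IsSymbol B (j + 2) (j + 1) R ∧
      (∀ ε t, 0 < t → HasDerivAt (a ε) (a' ε t) t) ∧
      ∀ ε t, ε ≠ 0 → 0 < t →
        a' ε t + a ε t ^ 2 + (ε⁻¹ + B 0 t) * a ε t + B 0 t / (2 * ε) = ε ^ j * R ε t := by
  induction j with
  | zero =>
    -- The value -B₀/2 balances the two terms of order ε⁻¹.
    refine ⟨fun _ t => -1 / 2 * B 0 t, fun _ t => -1 / 2 * B 1 t,
      fun _ t => -1 / 2 * B 1 t + -1 / 4 * (B 0 t * B 0 t), (base 0).const_mul _,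
      ((base 1).const_mul _).add ((((base 0).mul (base 0)).mono (Nat.le_succ 0)).const_mul _),
      fun ε t ht => ((hB.hasDerivAt 0 hj t ht).ofReal_comp).const_mul _, fun ε t hε _ => ?_⟩
    field_simp
    ring
  | succ j ih =>
    obtain ⟨a, a', R, ha, hR, ha', h⟩ := ih (Nat.lt_of_succ_lt hj)
    obtain ⟨R', hR', hRd⟩ := hR.exists_hasDerivAt hB hj
    have s1 : IsSymbol B 1 (j + 1) fun ε t => ε ^ (j + 1) * R ε t :=
      param_pow_mul (j + 1) (by rwa [add_comm 1 (j + 1)])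
    have s2 : IsSymbol B (j + 3) (j + 2) fun ε t => ε ^ (j + 1) * (R ε t * R ε t) :=
      param_pow_mul (j + 1) (by
        have := hR.mul hR
        rw [show j + 2 + (j + 2) = j + 3 + (j + 1) by ring] at this
        exact this.mono (Nat.le_succ _))
    have s3 : IsSymbol B (j + 3) (j + 2) fun ε t => a ε t * R ε t := by
      have := (ha.mono (Nat.le_succ j)).mul hR
      rw [show 1 + (j + 2) = j + 3 by ring] at this
      exact this.mono (Nat.le_succ _)
    have s4 : IsSymbol B (j + 3) (j + 2) fun ε t => B 0 t * R ε t := by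
      have := ((base (B := B) 0).mono (Nat.zero_le (j + 1))).mul hR
      rw [show 0 + 1 + (j + 2) = j + 3 by ring] at this
      exact this.mono (Nat.le_succ _)
    -- Subtracting ε^(j+1) R cancels the old residual through the term ε⁻¹a. What remains has one
    -- more power of ε, at the price of one more derivative of b.
    refine ⟨fun ε t => a ε t + -1 * (ε ^ (j + 1) * R ε t),
      fun ε t => a' ε t + -1 * (ε ^ (j + 1) * R' ε t),
      fun ε t => (-1 * R' ε t + -2 * (a ε t * R ε t)) + (-1 * (B 0 t * R ε t) +
        ε ^ (j + 1) * (R ε t * R ε t)), (ha.mono (Nat.le_succ j)).add (s1.const_mul _),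
      ((hR'.const_mul _).add (s3.const_mul _)).add ((s4.const_mul _).add s2),
      fun ε t ht => (ha' ε t ht).add (((hRd ε t ht).const_mul _).const_mul _),
      fun ε t hε ht => ?_⟩
    have e := h ε t hε ht
    have e1 : ε⁻¹ * ε ^ (j + 1) = ε ^ j := by rw [pow_succ']; field_simp
    linear_combination e - e1 * R ε t

end IsSymbol

/-! ### The WKB estimate before the zone boundary. -/

/-- Write ψ = α + iβ; the numerator is |v - ψy|². If ψ solves the Riccati equation exactly, then (v
- ψy)' = -(b + ψ)(v - ψy) and β' = -(b + 2α)β, so the quotient has logarithmic derivative -b. The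
residuals ρ₁ and ρ₂ contribute at most 4δ/β. -/
theorem deriv_hyperbolic_energy_le {r b y v α β α' β' ρ₁ ρ₂ δ : ℝ} (hβ : 0 < β)
    (h₁ : α' + α ^ 2 - β ^ 2 + b * α + r ^ 2 = ρ₁) (h₂ : β' + 2 * α * β + b * β = ρ₂)
    (hρ₁ : |ρ₁| ≤ δ) (hρ₂ : |ρ₂| ≤ δ) :
    ((2 * (v - α * y) * (-(r ^ 2 * y) - b * v - (α' * y + α * v)) +
      (2 * β * β' * y ^ 2 + β ^ 2 * (2 * y * v))) * β - ((v - α * y) ^ 2 + β ^ 2 * y ^ 2) * β') /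
        β ^ 2 ≤ (-b + 4 * δ / β) * (((v - α * y) ^ 2 + β ^ 2 * y ^ 2) / β) := by
  obtain ⟨u, hu⟩ : ∃ u, u = v - α * y := ⟨_, rfl⟩
  have hδ : 0 ≤ δ := (abs_nonneg _).trans hρ₁
  obtain rfl : v = u + α * y := by rw [hu]; ring
  obtain rfl : α' = ρ₁ - (α ^ 2 - β ^ 2 + b * α + r ^ 2) := by linarith
  obtain rfl : β' = ρ₂ - (2 * α * β + b * β) := by linarith
  have h3 : |2 * β * (u * y)| ≤ u ^ 2 + β ^ 2 * y ^ 2 := by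
    rw [abs_le]; constructor <;> nlinarith [sq_nonneg (u - β * y), sq_nonneg (u + β * y)]
  have h4 : -(ρ₁ * (2 * β * (u * y))) ≤ δ * (u ^ 2 + β ^ 2 * y ^ 2) := by
    refine (neg_le_abs _).trans ?_
    rw [abs_mul]; gcongr
  have h5 : ρ₂ * (2 * (β ^ 2 * y ^ 2)) ≤ δ * (2 * (u ^ 2 + β ^ 2 * y ^ 2)) := by
    have := (le_abs_self _).trans hρ₂
    gcongr
    nlinarith [sq_nonneg u]
  have h6 : -ρ₂ * (u ^ 2 + β ^ 2 * y ^ 2) ≤ δ * (u ^ 2 + β ^ 2 * y ^ 2) := by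
    gcongr; exact (neg_le_abs _).trans hρ₂
  rw [show u + α * y - α * y = u by ring, div_le_iff₀ (by positivity)]
  have e1 : (-b + 4 * δ / β) * ((u ^ 2 + β ^ 2 * y ^ 2) / β) * β ^ 2 =
      -b * (u ^ 2 + β ^ 2 * y ^ 2) * β + 4 * δ * (u ^ 2 + β ^ 2 * y ^ 2) := by field_simp
  rw [e1]
  linarith

/-- WKB estimate in the region where the frequency dominates the oscillations of `b`. -/
theorem IsDerivSeq.exists_energy_le {m : ℕ} {B : ℕ → ℝ → ℝ} {Ξ : ℝ → ℝ} (hB : IsDerivSeq m B Ξ)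
    (hm : 1 ≤ m) (hΞ : ContinuousOn Ξ (Ici 0)) :
    ∃ N C : ℝ, 0 < N ∧ 0 < C ∧ ∀ (r t₁ : ℝ) (y v : ℝ → ℝ), 0 < r → 0 ≤ t₁ →
      (∀ t ∈ Icc 0 t₁, N * Ξ t ≤ r) → IsModeOn (B 0) r 0 t₁ y v →
      r ^ 2 * y t₁ ^ 2 + v t₁ ^ 2 ≤ 20 / 3 *
        Real.exp (C * ((∫ s in (0 : ℝ)..t₁, Ξ s ^ (m + 1)) / r ^ m)) *
        Real.exp (-∫ s in (0 : ℝ)..t₁, B 0 s) * (r ^ 2 * y 0 ^ 2 + v 0 ^ 2) := by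
  obtain ⟨j, rfl⟩ : ∃ j, m = j + 1 := ⟨m - 1, by omega⟩
  obtain ⟨a, a', R, ha, hR, ha', hric⟩ := IsSymbol.exists_riccati hB j (Nat.lt_succ_self j)
  obtain ⟨C₁, hC₁, H₁⟩ := ha.exists_norm_le hB (Nat.le_succ j)
  obtain ⟨C₂, hC₂, H₂⟩ := hR.exists_norm_le hB le_rfl
  have hac := ha.continuousOn hB (Nat.le_succ j)
  -- The first constant forces Ξ ≤ r and |a| ≤ r/4, so β stays within [3r/4, 5r/4].
  refine ⟨1 + 4 * C₁, 1 + 16 / 3 * C₂, by positivity, by positivity, ?_⟩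
  intro r t₁ y v hr ht₁ hN hmode
  -- With ψ = ir + a, the Riccati equation for ψ has linear coefficient 2ir + b = ε⁻¹ + b and source
  -- irb = b/(2ε).
  set ε : ℂ := (2 * Complex.I * r)⁻¹ with hε
  have hrC : (r : ℂ) ≠ 0 := by exact_mod_cast hr.ne'
  have hε0 : ε ≠ 0 := by simp [hε, hrC]
  have hεn : ‖ε‖ = (2 * r)⁻¹ := by simp [hε, abs_of_pos hr]
  have hΞr : ∀ t ∈ Icc 0 t₁, Ξ t ≤ r ∧ 4 * (C₁ * Ξ t) ≤ r := fun t ht => by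
    have h1 := hN t ht
    have h2 := hB.pos t ht.1
    constructor <;> nlinarith [mul_nonneg hC₁ h2.le]
  have hεΞ : ∀ t ∈ Icc 0 t₁, ‖ε‖ * Ξ t ≤ 1 := fun t ht => by
    rw [hεn, inv_mul_le_iff₀ (by positivity)]
    linarith [(hΞr t ht).1]
  have haN : ∀ t ∈ Icc 0 t₁, ‖a ε t‖ ≤ r / 4 := fun t ht => by
    have := H₁ ε t ht.1 (hεΞ t ht)
    rw [pow_one] at this
    linarith [(hΞr t ht).2]
  set α : ℝ → ℝ := fun t => (a ε t).re with hα
  set β : ℝ → ℝ := fun t => r + (a ε t).im with hβ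
  have hαb : ∀ t ∈ Icc 0 t₁, |α t| ≤ r / 4 := fun t ht =>
    (Complex.abs_re_le_norm _).trans (haN t ht)
  have hβb : ∀ t ∈ Icc 0 t₁, 3 / 4 * r ≤ β t ∧ β t ≤ 5 / 4 * r := fun t ht => by
    have := abs_le.1 ((Complex.abs_im_le_norm _).trans (haN t ht))
    simp only [hβ]
    constructor <;> linarith
  have hβ0 : ∀ t ∈ Icc 0 t₁, 0 < β t := fun t ht => by linarith [(hβb t ht).1]
  have hIci : Icc 0 t₁ ⊆ Ici (0 : ℝ) := fun t ht => ht.1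
  have hαc : ContinuousOn α (Icc 0 t₁) :=
    Complex.continuous_re.comp_continuousOn ((hac ε).mono hIci)
  have hβc : ContinuousOn β (Icc 0 t₁) :=
    continuousOn_const.add (Complex.continuous_im.comp_continuousOn ((hac ε).mono hIci))
  have hα' : ∀ t, 0 < t → HasDerivAt α (a' ε t).re t := fun t ht => by
    exact (Complex.reCLM.hasFDerivAt.comp_hasDerivAt t (ha' ε t ht))
  have hβ' : ∀ t, 0 < t → HasDerivAt β (a' ε t).im t := fun t ht => by
    exact (Complex.imCLM.hasFDerivAt.comp_hasDerivAt t (ha' ε t ht)).const_add r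
  have hb := hB.continuousOn 0 (Nat.zero_le _)
  have hΞp : ContinuousOn (fun s => Ξ s ^ (j + 1 + 1)) (Ici 0) := hΞ.pow _
  -- Here β ≥ 3r/4 gives 4/β ≤ 16/(3r), and the residual is at most C₂ Ξ^(j+2) / r^j.
  set D : ℝ := 16 / 3 * C₂ / r ^ (j + 1) with hD
  have key := le_mul_exp_of_hasDerivAt_le
    (f := fun t => ((v t - α t * y t) ^ 2 + β t ^ 2 * y t ^ 2) / β t)
    (G := fun t => -(∫ s in (0 : ℝ)..t, B 0 s) + D * ∫ s in (0 : ℝ)..t, Ξ s ^ (j + 1 + 1))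
    (g := fun t => -B 0 t + D * Ξ t ^ (j + 1 + 1))
    (f' := fun t => ((2 * (v t - α t * y t) * (-(r ^ 2 * y t) - B 0 t * v t -
      ((a' ε t).re * y t + α t * v t)) + (2 * β t * (a' ε t).im * y t ^ 2 + β t ^ 2 *
      (2 * y t * v t))) * β t - ((v t - α t * y t) ^ 2 + β t ^ 2 * y t ^ 2) * (a' ε t).im) /
        β t ^ 2) ht₁ ?_ ?_ ?_ ?_ ?_
  · have h0 : (0 : ℝ) ∈ Icc 0 t₁ := ⟨le_rfl, ht₁⟩
    have h1 : t₁ ∈ Icc 0 t₁ := ⟨ht₁, le_rfl⟩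
    set I := ∫ s in (0 : ℝ)..t₁, Ξ s ^ (j + 1 + 1) with hI
    have hI0 : 0 ≤ I := intervalIntegral.integral_nonneg ht₁ fun s hs => by
      have := hB.pos s hs.1
      positivity
    have hexp : Real.exp (-(∫ s in (0 : ℝ)..t₁, B 0 s) + D * I - (-(∫ s in (0 : ℝ)..0, B 0 s) +
        D * ∫ s in (0 : ℝ)..0, Ξ s ^ (j + 1 + 1))) ≤
        Real.exp ((1 + 16 / 3 * C₂) * (I / r ^ (j + 1))) *
          Real.exp (-∫ s in (0 : ℝ)..t₁, B 0 s) := by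
      rw [← Real.exp_add]
      apply Real.exp_le_exp.2
      have : D * I = 16 / 3 * C₂ * (I / r ^ (j + 1)) := by rw [hD]; ring
      have h3 : 0 ≤ I / r ^ (j + 1) := by positivity
      simp only [intervalIntegral.integral_same]
      linarith
    set W := Real.exp ((1 + 16 / 3 * C₂) * (I / r ^ (j + 1))) *
          Real.exp (-∫ s in (0 : ℝ)..t₁, B 0 s) with hW
    have hW0 : 0 < W := by positivity
    set F : ℝ → ℝ := fun t => (v t - α t * y t) ^ 2 + β t ^ 2 * y t ^ 2 with hF
    have hF0 : ∀ t, 0 ≤ F t := fun t => by positivity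
    have b1 : ∀ t ∈ Icc 0 t₁, r ^ 2 * y t ^ 2 + v t ^ 2 ≤ 2 * F t ∧
        F t ≤ 2 * (r ^ 2 * y t ^ 2 + v t ^ 2) := fun t ht => by
      have c1 : α t ^ 2 ≤ (r / 4) ^ 2 := sq_le_sq' (abs_le.1 (hαb t ht)).1 (abs_le.1 (hαb t ht)).2
      have c2 : (3 / 4 * r) ^ 2 ≤ β t ^ 2 := by gcongr; exact (hβb t ht).1
      have c3 : β t ^ 2 ≤ (5 / 4 * r) ^ 2 := by
        have := hβ0 t ht
        gcongr; exact (hβb t ht).2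
      have d1 := mul_le_mul_of_nonneg_right c1 (sq_nonneg (y t))
      have d2 := mul_le_mul_of_nonneg_right c2 (sq_nonneg (y t))
      have d3 := mul_le_mul_of_nonneg_right c3 (sq_nonneg (y t))
      have d4 := sq_nonneg (v t - 2 * α t * y t)
      have d5 := sq_nonneg (v t + α t * y t)
      have d6 := mul_nonneg (sq_nonneg r) (sq_nonneg (y t))
      simp only [hF]
      constructor
      · nlinarith
      · nlinarith
    have k1 : F t₁ ≤ 5 / 3 * F 0 * W := by
      have k2 : F t₁ / β t₁ ≤ F 0 / β 0 * W := key.trans (by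
        have := div_nonneg (hF0 0) (hβ0 0 h0).le
        gcongr)
      rw [div_le_iff₀ (hβ0 _ h1)] at k2
      have k3 : β t₁ / β 0 ≤ 5 / 3 := by
        rw [div_le_iff₀ (hβ0 _ h0)]
        linarith [(hβb _ h0).1, (hβb _ h1).2]
      calc F t₁ ≤ (β t₁ / β 0) * F 0 * W := k2.trans_eq (by ring)
        _ ≤ _ := by
          have := hF0 0
          gcongr
    have k4 : 5 / 3 * F 0 * W ≤ 5 / 3 * (2 * (r ^ 2 * y 0 ^ 2 + v 0 ^ 2)) * W := by
      gcongr; exact (b1 0 h0).2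
    calc _ ≤ 2 * F t₁ := (b1 t₁ h1).1
      _ ≤ 2 * (5 / 3 * (2 * (r ^ 2 * y 0 ^ 2 + v 0 ^ 2)) * W) := by linarith
      _ = _ := by rw [hW]; ring
  · have h1 := hmode.1
    have h2 := hmode.2
    exact ((((h2.sub (hαc.mul h1)).pow 2).add ((hβc.pow 2).mul (h1.pow 2)))).div hβc
      fun t ht => (hβ0 t ht).ne'
  · exact ((continuousOn_integral_of_continuousOn_Ici hb).mono hIci).neg.add
      (((continuousOn_integral_of_continuousOn_Ici hΞp).mono hIci).const_mul D)
  · intro t ht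
    have e1 := ((hmode.4 t ht).sub ((hα' t ht.1).mul (hmode.3 t ht))).pow 2
    have e2 := ((hβ' t ht.1).pow 2).mul ((hmode.3 t ht).pow 2)
    refine ((e1.add e2).div (hβ' t ht.1) (hβ0 t (Ioo_subset_Icc_self ht)).ne').congr_deriv ?_
    simp
  · intro t ht
    exact (hasDerivAt_integral_of_continuousOn_Ici hb ht.1).neg.add
      ((hasDerivAt_integral_of_continuousOn_Ici hΞp ht.1).const_mul D)
  · intro t ht
    have ht' := Ioo_subset_Icc_self ht
    set ρ := ε ^ j * R ε t with hρ
    have e := hric ε t hε0 ht.1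
    have e1 : a' ε t + a ε t ^ 2 + (2 * Complex.I * r + B 0 t) * a ε t +
        B 0 t * (Complex.I * r) = ρ := by
      rw [hρ, ← e, hε, inv_inv]
      have : 2 * (2 * Complex.I * (r : ℂ))⁻¹ = (Complex.I * r)⁻¹ := by
        have := Complex.I_ne_zero
        field_simp
      rw [this, div_inv_eq_mul]
    have hre := congrArg Complex.re e1
    have him := congrArg Complex.im e1
    simp [pow_two] at hre him
    have hρn : ‖ρ‖ ≤ C₂ * Ξ t ^ (j + 2) / r ^ j := by
      have h1 := H₂ ε t ht'.1 (hεΞ t ht')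
      rw [hρ, norm_mul, norm_pow, hεn, div_eq_inv_mul]
      have h2 : ((2 * r)⁻¹) ^ j ≤ (r ^ j)⁻¹ := by
        rw [← inv_pow]
        have : (2 * r)⁻¹ ≤ r⁻¹ := by gcongr; linarith
        gcongr
      have := hB.pos t ht'.1
      gcongr
    have main := deriv_hyperbolic_energy_le (r := r) (b := B 0 t) (y := y t) (v := v t) (α := α t)
      (α' := (a' ε t).re) (β' := (a' ε t).im) (hβ0 t ht') (ρ₁ := ρ.re) (ρ₂ := ρ.im) (δ := ‖ρ‖)
      (by simp only [hα, hβ]; linear_combination hre) (by simp only [hα, hβ]; linear_combination him)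
      (Complex.abs_re_le_norm _) (Complex.abs_im_le_norm _)
    refine main.trans ?_
    have hβt := hβ0 t ht'
    have hfin : 4 * ‖ρ‖ / β t ≤ D * Ξ t ^ (j + 1 + 1) := by
      rw [div_le_iff₀ hβt]
      calc 4 * ‖ρ‖ ≤ 4 * (C₂ * Ξ t ^ (j + 2) / r ^ j) := by gcongr
        _ = D * Ξ t ^ (j + 1 + 1) * (3 / 4 * r) := by rw [hD]; field_simp; ring
        _ ≤ _ := by
          have := hB.pos t ht'.1
          gcongr
          exact (hβb t ht').1
    have : 0 ≤ ((v t - α t * y t) ^ 2 + β t ^ 2 * y t ^ 2) / β t := by positivity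
    gcongr

/-! ### Combined decay for bounded frequencies, without loss in ρ. -/

/-- Energy decay after time `T` for frequencies in a bounded set. -/
theorem IsStableDamping.energy_le_of_le {b μ μ' M S : ℝ → ℝ} {T μ₀ K : ℝ}
    (h : IsStableDamping b μ μ' M S T μ₀ K) {J : ℝ → ℝ} {r t R W : ℝ} {y v : ℝ → ℝ}
    (hm : IsModeOn b r T t y v) (hr : 0 ≤ r) (hrR : r ≤ R) (ht : T ≤ t)
    (hJ : ContinuousOn J (Icc T t)) (hJ' : ∀ s ∈ Ioo T t, HasDerivAt J |S s| s)
    (hW : ∀ s ∈ Icc T t, r * (J t - J s) ≤ W) (hW0 : 0 ≤ W) :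
    r ^ 2 * y t ^ 2 + v t ^ 2 ≤ (3 * K ^ 4 * Real.exp 1 * Real.exp (6 * K * W)) * (1 + R ^ 2) *
      (2 * K ^ 4 * Real.exp (K / (1 - μ₀) + K)) * Real.exp (-(M t - M T)) *
        (y T ^ 2 + v T ^ 2) := by
  have hK := h.one_le
  have hT0 := h.nonneg
  have hK4 : 1 ≤ K ^ 4 := one_le_pow₀ hK
  have hμ₀ : 0 < 1 - μ₀ := by linarith [h.lt_one]
  -- All three factors are at least 1, so their product serves every case below.
  have f1 : 1 ≤ 3 * K ^ 4 * Real.exp 1 * Real.exp (6 * K * W) := by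
    have e1 : 1 ≤ Real.exp 1 := Real.one_le_exp zero_le_one
    have e2 : 1 ≤ Real.exp (6 * K * W) := Real.one_le_exp (by positivity)
    nlinarith [mul_le_mul e1 e2 zero_le_one (by positivity),
      mul_le_mul hK4 (mul_le_mul e1 e2 zero_le_one (by positivity)) (by norm_num) (by positivity)]
  have f2 : 1 ≤ 1 + R ^ 2 := by nlinarith [sq_nonneg R]
  have f3 : 1 ≤ 2 * K ^ 4 * Real.exp (K / (1 - μ₀) + K) := by
    have e1 : 1 ≤ Real.exp (K / (1 - μ₀) + K) := Real.one_le_exp (by positivity)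
    nlinarith [mul_le_mul hK4 e1 zero_le_one (by positivity)]
  set L₁ := 3 * K ^ 4 * Real.exp 1 * Real.exp (6 * K * W) with hL₁
  set L₂ := 1 + R ^ 2 with hL₂
  set L₃ := 2 * K ^ 4 * Real.exp (K / (1 - μ₀) + K) with hL₃
  have hr2 : r ^ 2 ≤ R ^ 2 := by gcongr
  have high : ∀ s ∈ Icc T t, 0 < r → 1 ≤ r * (1 + s) → r ^ 2 * y t ^ 2 + v t ^ 2 ≤
      L₁ * Real.exp (-(M t - M s)) * (r ^ 2 * y s ^ 2 + v s ^ 2) := fun s hs hr0 h1 => by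
    refine (h.energy_le (hm.mono hs.1 le_rfl) hr0 hs.1 hs.2 h1
      (hJ.mono (Icc_subset_Icc hs.1 le_rfl))
      fun x hx => hJ' x ⟨hs.1.trans_lt hx.1, hx.2⟩).trans ?_
    have := hW s hs
    rw [hL₁]
    gcongr
  set E := y T ^ 2 + v T ^ 2 with hE
  have hE0 : 0 ≤ E := by positivity
  set X := Real.exp (-(M t - M T)) with hX
  have hX0 : 0 < X := Real.exp_pos _
  rcases le_total (r * (1 + t)) 1 with h1 | h1
  · have := h.energy_le_of_mul_le_one hm hr le_rfl ht h1
    calc _ ≤ 1 * 1 * L₃ * X * E := by rw [one_mul, one_mul]; exact this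
      _ ≤ _ := by gcongr
  have hr0 : 0 < r := by
    rcases hr.lt_or_eq with h2 | h2
    · exact h2
    · rw [← h2] at h1; norm_num at h1
  rcases le_total 1 (r * (1 + T)) with h2 | h2
  · have e1 : r ^ 2 * y T ^ 2 + v T ^ 2 ≤ L₂ * E := by
      have e3 := mul_le_mul_of_nonneg_right hr2 (sq_nonneg (y T))
      have e4 := mul_nonneg (sq_nonneg R) (sq_nonneg (v T))
      rw [hL₂, hE]
      nlinarith [sq_nonneg (y T)]
    calc _ ≤ L₁ * X * (r ^ 2 * y T ^ 2 + v T ^ 2) := high T ⟨le_rfl, ht⟩ hr0 h2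
      _ ≤ L₁ * X * (L₂ * E) := by gcongr
      _ = L₁ * L₂ * 1 * X * E := by ring
      _ ≤ _ := by gcongr
  · have hs1 : r * (1 + (1 / r - 1)) = 1 := by field_simp; ring
    -- At this time r(1+s) = 1, and the two regimes are glued there.
    set s := 1 / r - 1 with hs
    have hTs : T ≤ s := by
      by_contra! hlt
      nlinarith
    have hst : s ≤ t := by
      by_contra! hlt
      nlinarith
    have l1 := h.energy_le_of_mul_le_one (hm.mono le_rfl hst) hr le_rfl hTs hs1.le
    calc _ ≤ L₁ * Real.exp (-(M t - M s)) * (r ^ 2 * y s ^ 2 + v s ^ 2) :=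
          high s ⟨hTs, hst⟩ hr0 hs1.ge
      _ ≤ L₁ * Real.exp (-(M t - M s)) * (L₃ * Real.exp (-(M s - M T)) * E) := by gcongr
      _ = L₁ * 1 * L₃ * (Real.exp (-(M t - M s)) * Real.exp (-(M s - M T))) * E := by ring
      _ = L₁ * 1 * L₃ * X * E := by rw [← Real.exp_add, hX]; ring_nf
      _ ≤ _ := by gcongr

/-! ### The tail integral of σ and the consequences of the hypotheses on the damping. -/

section Tail

variable {σ : ℝ → ℝ} {l : ℝ}

theorem tailIntegral_eq (hσ : ∀ t, 0 ≤ t → IntervalIntegrable σ volume 0 t)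
    (hl : Tendsto (fun R : ℝ => ∫ s in (0 : ℝ)..R, σ s) atTop (𝓝 l)) {s : ℝ} (hs : 0 ≤ s) :
    tailIntegral σ s = l - ∫ x in (0 : ℝ)..s, σ x := by
  refine Tendsto.limUnder_eq ((hl.sub_const _).congr' ?_)
  filter_upwards [eventually_ge_atTop 0] with R hR
  exact intervalIntegral.integral_interval_sub_left (hσ R hR) (hσ s hs)

theorem continuousOn_tailIntegral (hσ : ∀ t, 0 ≤ t → IntervalIntegrable σ volume 0 t)
    (hl : Tendsto (fun R : ℝ => ∫ s in (0 : ℝ)..R, σ s) atTop (𝓝 l)) :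
    ContinuousOn (tailIntegral σ) (Ici 0) :=
  (continuousOn_const.sub (continuousOn_integral_of_intervalIntegrable hσ)).congr
    fun _ hs => tailIntegral_eq hσ hl hs

theorem exists_abs_tailIntegral_le (hσ : ∀ t, 0 ≤ t → IntervalIntegrable σ volume 0 t)
    (hl : Tendsto (fun R : ℝ => ∫ s in (0 : ℝ)..R, σ s) atTop (𝓝 l)) :
    ∃ C : ℝ, 0 ≤ C ∧ ∀ s, 0 ≤ s → |tailIntegral σ s| ≤ C := by
  have h0 : Tendsto (fun s => l - ∫ x in (0 : ℝ)..s, σ x) atTop (𝓝 (l - l)) := hl.const_sub l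
  rw [sub_self] at h0
  obtain ⟨R, hR⟩ := eventually_atTop.1 (h0.eventually (Metric.ball_mem_nhds 0 one_pos))
  obtain ⟨C, hC⟩ := (isCompact_Icc (a := (0 : ℝ)) (b := R)).exists_bound_of_continuousOn
    ((continuousOn_tailIntegral hσ hl).mono fun _ hx => hx.1)
  refine ⟨max 1 C, by positivity, fun s hs => ?_⟩
  rcases le_total s R with h | h
  · exact (hC s ⟨hs, h⟩).trans (le_max_right _ _)
  · have := hR s h
    rw [tailIntegral_eq hσ hl hs]
    rw [dist_zero_right, Real.norm_eq_abs] at this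
    exact this.le.trans (le_max_left _ _)

end Tail

theorem NonEffectiveDamping.intervalIntegrable_sub {b μ : ℝ → ℝ} (h : NonEffectiveDamping b μ)
    (hb : ContinuousOn b (Ici 0)) (t : ℝ) (ht : 0 ≤ t) :
    IntervalIntegrable (fun t => b t - μ t) volume 0 t :=
  (intervalIntegrable_of_continuousOn_Ici hb le_rfl ht).sub (h.locallyIntegrable t ht)

theorem NonEffectiveDamping.exists_isStableDamping {b μ : ℝ → ℝ} (h : NonEffectiveDamping b μ)
    (hb : ContinuousOn b (Ici 0)) :
    ∃ T μ₀ K, IsStableDamping b μ (deriv μ) (fun t => ∫ s in (0 : ℝ)..t, μ s)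
      (tailIntegral fun t => b t - μ t) T μ₀ K ∧
      ∀ t, 0 ≤ t → |tailIntegral (fun t => b t - μ t) t| ≤ Real.log K := by
  obtain ⟨T, hT, ⟨μ₀, hμ₀, hlub⟩, hpos, hder⟩ := h.eventually_small_pos_decreasing
  obtain ⟨l, hl⟩ := h.converges
  have hσ := h.intervalIntegrable_sub hb
  obtain ⟨C, hC0, hC⟩ := exists_abs_tailIntegral_le hσ hl
  -- `derivWithin` is 0 where the derivative does not exist, so strict negativity already entails
  -- differentiability.
  have hdiff : ∀ t, T ≤ t → DifferentiableWithinAt ℝ μ (Ici 0) t := fun t ht => by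
    by_contra hn
    have := hder t ht
    rw [derivWithin_zero_of_not_differentiableWithinAt hn] at this
    exact lt_irrefl _ this
  have hμc : ContinuousOn μ (Ici T) := fun t ht =>
    (hdiff t ht).continuousWithinAt.mono (Ici_subset_Ici.2 hT)
  have hμd : ∀ t, T < t → HasDerivAt μ (deriv μ t) t := fun t ht =>
    ((hdiff t ht.le).differentiableAt (Ici_mem_nhds (hT.trans_lt ht))).hasDerivAt
  have hprim : ∀ f : ℝ → ℝ, (∀ t, 0 ≤ t → IntervalIntegrable f volume 0 t) →
      ContinuousOn f (Ici T) → ∀ t, T < t →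
      HasDerivAt (fun s => ∫ x in (0 : ℝ)..s, f x) (f t) t := fun f hf hfc t ht =>
    intervalIntegral.integral_hasDerivAt_right (hf t (hT.trans ht.le))
      ((hfc.mono Ioi_subset_Ici_self).stronglyMeasurableAtFilter isOpen_Ioi t ht)
      ((hfc t ht.le).continuousAt (Ici_mem_nhds ht))
  refine ⟨T, μ₀, Real.exp C, ⟨hT, hμ₀, Real.one_le_exp hC0, hμc,
    (continuousOn_integral_of_intervalIntegrable h.locallyIntegrable).mono (Ici_subset_Ici.2 hT),
    (continuousOn_tailIntegral hσ hl).mono (Ici_subset_Ici.2 hT), hμd,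
    hprim μ h.locallyIntegrable hμc, fun t ht => ?_, hpos, fun t ht => ?_,
    fun t ht => hlub.1 (mem_image_of_mem _ ht),
    fun t ht => Real.exp_le_exp.2 (hC t (hT.trans ht))⟩, fun t ht => by
      rw [Real.log_exp]; exact hC t ht⟩
  · refine ((hprim _ hσ ((hb.mono (Ici_subset_Ici.2 hT)).sub hμc) t ht).const_sub l).congr_of_eventuallyEq ?_
    filter_upwards [Ici_mem_nhds (hT.trans_lt ht)] with s hs
    exact tailIntegral_eq hσ hl hs
  · rw [← derivWithin_of_mem_nhds (Ici_mem_nhds (hT.trans_lt ht))]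
    exact (hder t ht.le).le

theorem isDerivSeq_iteratedDerivWithin {m : ℕ} {b Ξ : ℝ → ℝ} (hb : ContDiffOn ℝ m b (Ici 0))
    (hΞ : ∀ t, 0 ≤ t → 0 < Ξ t)
    (h : ∀ k : ℕ, k ≤ m → ∀ t, 0 ≤ t → |iteratedDerivWithin k b (Ici 0) t| ≤ Ξ t ^ (k + 1)) :
    IsDerivSeq m (fun k => iteratedDerivWithin k b (Ici 0)) Ξ where
  pos := hΞ
  continuousOn k hk := hb.continuousOn_iteratedDerivWithin (by exact_mod_cast hk)
    (uniqueDiffOn_Ici 0)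
  hasDerivAt k hk t ht := by
    have h1 := hb.differentiableOn_iteratedDerivWithin (m := k) (by exact_mod_cast hk)
      (uniqueDiffOn_Ici 0)
    have h2 := (h1 t ht.le).hasDerivWithinAt.hasDerivAt (Ici_mem_nhds ht)
    rwa [← iteratedDerivWithin_succ] at h2
  abs_apply_le := h

theorem zetaInv_mem {ρ : ℝ → ℝ} {y : ℝ} (h : y ∈ zeta ρ '' Ici 0) :
    0 ≤ zetaInv ρ y ∧ zeta ρ (zetaInv ρ y) = y := by
  obtain ⟨x, hx, rfl⟩ := h
  exact ⟨Function.invFunOn_mem ⟨x, hx, rfl⟩, Function.invFunOn_eq ⟨x, hx, rfl⟩⟩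

/-! ### Gluing the zones for a single mode. -/

set_option maxHeartbeats 1000000 in
/-- The energy of a single Fourier mode. -/
theorem exists_mode_energy_le {m : ℕ} (hm : 1 ≤ m)
    {ρ : ℝ → ℝ} (hρ : IsWeight ρ) {b μ : ℝ → ℝ} (hA1 : NonEffectiveDamping b μ)
    (hA2 : Stabilization (fun t => b t - μ t)) (hA3 : ContDiffOn ℝ m b (Ici 0)) {Θ Ξ : ℝ → ℝ}
    (hΘ_pos : ∀ t, 0 ≤ t → 0 < Θ t) (hΘ_mono : StrictMonoOn Θ (Ici 0))
    (hΘ_cont : ContinuousOn Θ (Ici 0)) (hΞ_pos : ∀ t, 0 ≤ t → 0 < Ξ t)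
    (hΞ_cont : ContinuousOn Ξ (Ici 0)) (hΘ_range : ∀ t, 0 ≤ t → Θ t ∈ zeta ρ '' Ici 0)
    (h_stb : ∀ t, 0 ≤ t → ∫ s in Ioi t, |tailIntegral (fun τ => b τ - μ τ) s| ≤ (Θ t)⁻¹)
    (h_Cm : ∀ k : ℕ, k ≤ m → ∀ t, 0 ≤ t → |iteratedDerivWithin k b (Ici 0) t| ≤ Ξ t ^ (k + 1))
    (h_XiTh : BddAbove ((fun t => Ξ t / zetaInv ρ (Θ t)) '' Ici 0))
    (h_ass : BddAbove ((fun t => Θ t / zetaInv ρ (Θ t) ^ (m + 1) *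
      ∫ s in (0 : ℝ)..t, Ξ s ^ (m + 1)) '' Ici 0)) :
    ∃ κ : ℝ, 0 < κ ∧ ∃ C : ℝ, 0 < C ∧ ∀ (r t : ℝ) (y v : ℝ → ℝ), 0 ≤ r → 0 ≤ t →
      IsModeOn b r 0 t y v →
      r ^ 2 * y t ^ 2 + v t ^ 2 ≤ C * Real.exp (2 * κ * ρ r) *
        ((1 + r ^ 2) * y 0 ^ 2 + v 0 ^ 2) * Real.exp (-∫ s in (0 : ℝ)..t, μ s) := by
  have hbc : ContinuousOn b (Ici 0) := hA3.continuousOn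
  obtain ⟨T, μ₀, K, hst, hSK⟩ := hA1.exists_isStableDamping hbc
  obtain ⟨l, hl⟩ := hA1.converges
  have hσ := hA1.intervalIntegrable_sub hbc
  obtain ⟨N₀, C₀, hN₀, hC₀, hwkb⟩ :=
    (isDerivSeq_iteratedDerivWithin hA3 hΞ_pos h_Cm).exists_energy_le hm hΞ_cont
  rw [iteratedDerivWithin_zero] at hwkb
  set S := tailIntegral fun t => b t - μ t with hS
  set M : ℝ → ℝ := fun t => ∫ s in (0 : ℝ)..t, μ s with hM
  set g : ℝ → ℝ := fun t => zetaInv ρ (Θ t) with hg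
  have hT := hst.nonneg
  have hK := hst.one_le
  have hK0 : 0 < K := by linarith
  have hgζ : ∀ t, 0 ≤ t → zeta ρ (g t) = Θ t := fun t ht => (zetaInv_mem (hΘ_range t ht)).2
  have hg0 : ∀ t, 0 ≤ t → 0 < g t := fun t ht => by
    refine (zetaInv_mem (hΘ_range t ht)).1.lt_of_ne fun h0 => ?_
    have h1 := hgζ t ht
    simp only [hg, ← h0, zeta, zero_div] at h1
    exact (hΘ_pos t ht).ne h1
  obtain ⟨C₁, hC₁⟩ := h_XiTh
  obtain ⟨C₂, hC₂⟩ := h_ass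
  have hC₁' : ∀ t, 0 ≤ t → Ξ t ≤ C₁ * g t := fun t ht =>
    (div_le_iff₀ (hg0 t ht)).1 (hC₁ (mem_image_of_mem _ ht))
  -- At t = 0 the integral vanishes, so 0 is one of the values bounded by C₂.
  have hC₂0 : 0 ≤ C₂ := by
    have := hC₂ (mem_image_of_mem _ (self_mem_Ici (a := (0 : ℝ))))
    simpa using this
  -- Three demands on N: ρ(r/N) ≤ ρ(r), the WKB condition N₀Ξ ≤ r, and r ≥ 1 whenever the frequency
  -- meets the zone boundary.
  set N : ℝ := max 1 (max (N₀ * C₁) (g 0)⁻¹) with hN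
  have hN1 : 1 ≤ N := le_max_left _ _
  have hN0 : 0 < N := by linarith
  have hNC : N₀ * C₁ ≤ N := (le_max_left _ _).trans (le_max_right _ _)
  have hNg : (g 0)⁻¹ ≤ N := (le_max_right _ _).trans (le_max_right _ _)
  have hζ := hρ.zeta_strictMonoOn
  have hρN : ∀ r, 0 ≤ r → ρ (r / N) ≤ ρ r := fun r hr =>
    hρ.strictMonoOn.monotoneOn (mem_Ici.2 (by positivity)) hr (div_le_self hr hN1)
  -- the oscillating part
  have hJ : ContinuousOn (fun t => ∫ s in (0 : ℝ)..t, |S s|) (Ici 0) :=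
    continuousOn_integral_of_continuousOn_Ici (continuousOn_tailIntegral hσ hl).abs
  have hJ' : ∀ t, 0 < t → HasDerivAt (fun t => ∫ s in (0 : ℝ)..t, |S s|) |S t| t := fun t ht =>
    hasDerivAt_integral_of_continuousOn_Ici (continuousOn_tailIntegral hσ hl).abs ht
  set J : ℝ → ℝ := fun t => ∫ s in (0 : ℝ)..t, |S s| with hJdef
  have hJΘ : ∀ s t, 0 ≤ s → s ≤ t → J t - J s ≤ (Θ s)⁻¹ := fun s t hs hst => by
    have hi := fun t ht => intervalIntegrable_of_continuousOn_Ici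
      (continuousOn_tailIntegral hσ hl).abs (le_refl (0 : ℝ)) (t := t) ht
    simp only [hJdef]
    rw [intervalIntegral.integral_interval_sub_left (hi t (hs.trans hst)) (hi s hs),
      intervalIntegral.integral_of_le hst]
    refine (setIntegral_mono_set ?_ (ae_of_all _ fun _ => abs_nonneg _)
      Ioc_subset_Ioi_self.eventuallyLE).trans (h_stb s hs)
    exact hA2.mono_set (Ioi_subset_Ioi hs)
  -- large frequencies
  set A₁ : ℝ := 20 / 3 * (Real.exp |l| * K) with hA₁
  have hyper : ∀ (r t : ℝ) (y v : ℝ → ℝ), 0 ≤ r → 0 ≤ t → Θ t ≤ zeta ρ (r / N) →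
      IsModeOn b r 0 t y v → r ^ 2 * y t ^ 2 + v t ^ 2 ≤ A₁ * Real.exp (C₀ * C₂ * ρ r) *
        ((1 + r ^ 2) * y 0 ^ 2 + v 0 ^ 2) * Real.exp (-M t) := by
    intro r t y v hr ht hΘt hmode
    have hgr : ∀ s ∈ Icc 0 t, g s ≤ r / N := fun s hs => by
      refine (hζ.le_iff_le (hg0 s hs.1).le (mem_Ici.2 (by positivity))).1 ?_
      rw [hgζ s hs.1]
      exact (hΘ_mono.monotoneOn hs.1 ht hs.2).trans hΘt
    have hr0 : 0 < r := by
      have := (hg0 t ht).trans_le (hgr t ⟨ht, le_rfl⟩)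
      rwa [lt_div_iff₀ hN0, zero_mul] at this
    have h1 := hwkb r t y v hr0 ht (fun s hs => by
      calc N₀ * Ξ s ≤ N₀ * (C₁ * g s) := by gcongr; exact hC₁' s hs.1
        _ = N₀ * C₁ * g s := by ring
        _ ≤ N * (r / N) := mul_le_mul hNC (hgr s hs) (hg0 s hs.1).le hN0.le
        _ = r := by field_simp) hmode
    refine h1.trans ?_
    have hgt := hg0 t ht
    have hgtr := hgr t ⟨ht, le_rfl⟩
    have hI : (∫ s in (0 : ℝ)..t, Ξ s ^ (m + 1)) / r ^ m ≤ C₂ * ρ r := by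
      have h2 : Θ t / g t ^ (m + 1) * (∫ s in (0 : ℝ)..t, Ξ s ^ (m + 1)) ≤ C₂ :=
        hC₂ (mem_image_of_mem _ ht)
      -- Because Θ = ζ(g) = g/ρ(g), the hypothesis reads ∫Ξ^(m+1) ≤ C₂ g^m ρ(g).
      have h3 : Θ t / g t ^ (m + 1) = (g t ^ m * ρ (g t))⁻¹ := by
        have := hρ.pos (g t) hgt.le
        rw [← hgζ t ht, zeta]; field_simp; ring
      have hρg := hρ.pos (g t) hgt.le
      rw [h3, inv_mul_le_iff₀ (by positivity)] at h2
      rw [div_le_iff₀ (by positivity)]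
      have hgr' : g t ≤ r := hgtr.trans (div_le_self hr hN1)
      have h4 : ρ (g t) ≤ ρ r := hρ.strictMonoOn.monotoneOn hgt.le hr hgr'
      calc _ ≤ g t ^ m * ρ (g t) * C₂ := h2
        _ ≤ r ^ m * ρ r * C₂ := by gcongr
        _ = _ := by ring
    have hbM : -∫ s in (0 : ℝ)..t, b s = -(∫ s in (0 : ℝ)..t, (b s - μ s)) + -M t := by
      rw [intervalIntegral.integral_sub
        (intervalIntegrable_of_continuousOn_Ici hbc le_rfl ht) (hA1.locallyIntegrable t ht)]
      simp only [hM]; ring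
    -- Here ∫₀ᵗ σ = l - S(t) and |S| ≤ log K.
    have hexp : Real.exp (-∫ s in (0 : ℝ)..t, b s) ≤ Real.exp |l| * K * Real.exp (-M t) := by
      have h8 : Real.exp |l| * K = Real.exp (|l| + Real.log K) := by
        rw [Real.exp_add, Real.exp_log hK0]
      rw [hbM, Real.exp_add, h8]
      refine mul_le_mul_of_nonneg_right (Real.exp_le_exp.2 ?_) (Real.exp_pos _).le
      have h5 := tailIntegral_eq hσ hl ht
      have h6 := abs_le.1 (hSK t ht)
      have h7 := neg_abs_le l
      rw [← hS] at h5
      linarith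
    have hexp2 : Real.exp (C₀ * ((∫ s in (0 : ℝ)..t, Ξ s ^ (m + 1)) / r ^ m)) ≤
        Real.exp (C₀ * C₂ * ρ r) := by
      rw [mul_assoc]; gcongr
    calc _ ≤ 20 / 3 * Real.exp (C₀ * C₂ * ρ r) * (Real.exp |l| * K * Real.exp (-M t)) *
          (r ^ 2 * y 0 ^ 2 + v 0 ^ 2) := by gcongr
      _ ≤ 20 / 3 * Real.exp (C₀ * C₂ * ρ r) * (Real.exp |l| * K * Real.exp (-M t)) *
          ((1 + r ^ 2) * y 0 ^ 2 + v 0 ^ 2) := by gcongr; linarith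
      _ = _ := by rw [hA₁]; ring
  -- small frequencies, bounded times
  set R : ℝ := N * g T with hR
  have hsmall : ∀ r, 0 ≤ r → zeta ρ (r / N) ≤ Θ T → r ≤ R := fun r hr h => by
    rw [← hgζ T hT] at h
    have := (hζ.le_iff_le (mem_Ici.2 (by positivity)) (hg0 T hT).le).1 h
    rwa [div_le_iff₀' hN0] at this
  obtain ⟨B, hB⟩ := (isCompact_Icc (a := (0 : ℝ)) (b := T)).exists_bound_of_continuousOn
    (hbc.mono fun _ hx => hx.1)
  have hB0 : 0 ≤ B := (norm_nonneg _).trans (hB 0 ⟨le_rfl, hT⟩)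
  obtain ⟨Mb, hMb⟩ := (isCompact_Icc (a := (0 : ℝ)) (b := T)).exists_bound_of_continuousOn
    ((continuousOn_integral_of_intervalIntegrable hA1.locallyIntegrable).mono fun _ hx => hx.1)
  -- The sign of μ is unknown before T, so exp(-M) is inserted at the price of a bound for |M| on
  -- [0, T].
  set A₂ : ℝ := Real.exp ((1 + R ^ 2 + 2 * B) * T) * Real.exp Mb with hA₂
  have crude : ∀ (r t : ℝ) (y v : ℝ → ℝ), 0 ≤ r → r ≤ R → t ∈ Icc 0 T →
      IsModeOn b r 0 t y v → y t ^ 2 + v t ^ 2 ≤ A₂ *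
        ((1 + r ^ 2) * y 0 ^ 2 + v 0 ^ 2) * Real.exp (-M t) := by
    intro r t y v hr hrR ht hmode
    have h1 := hmode.sq_add_sq_le ht.1 hr hrR (B := B) fun s hs => hB s ⟨hs.1, hs.2.trans ht.2⟩
    have h2 : Real.exp ((1 + R ^ 2 + 2 * B) * (t - 0)) ≤ Real.exp ((1 + R ^ 2 + 2 * B) * T) := by
      gcongr; linarith [ht.2]
    have h3 : 1 ≤ Real.exp Mb * Real.exp (-M t) := by
      rw [← Real.exp_add]
      apply Real.one_le_exp
      have := (le_abs_self _).trans (hMb t ht)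
      linarith
    have h4 : y 0 ^ 2 + v 0 ^ 2 ≤ (1 + r ^ 2) * y 0 ^ 2 + v 0 ^ 2 := by
      nlinarith [mul_nonneg (sq_nonneg r) (sq_nonneg (y 0))]
    calc _ ≤ ((1 + r ^ 2) * y 0 ^ 2 + v 0 ^ 2) * Real.exp ((1 + R ^ 2 + 2 * B) * T) * 1 := by
          rw [mul_one]; exact h1.trans (by gcongr)
      _ ≤ ((1 + r ^ 2) * y 0 ^ 2 + v 0 ^ 2) * Real.exp ((1 + R ^ 2 + 2 * B) * T) *
          (Real.exp Mb * Real.exp (-M t)) := by gcongr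
      _ = _ := by rw [hA₂]; ring
  -- small frequencies, large times
  set W : ℝ := R * (Θ 0)⁻¹ with hW
  have hΘ0 := hΘ_pos 0 le_rfl
  have hR0 : 0 < R := mul_pos hN0 (hg0 T hT)
  have hμ₀ : 0 < 1 - μ₀ := by linarith [hst.lt_one]
  set A₃ : ℝ := (3 * K ^ 4 * Real.exp 1 * Real.exp (6 * K * W)) * (1 + R ^ 2) *
      (2 * K ^ 4 * Real.exp (K / (1 - μ₀) + K)) with hA₃
  have hA₃0 : 0 < A₃ := by positivity
  have low : ∀ (r t : ℝ) (y v : ℝ → ℝ), 0 ≤ r → r ≤ R → T ≤ t →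
      IsModeOn b r 0 t y v → r ^ 2 * y t ^ 2 + v t ^ 2 ≤ A₃ * A₂ *
        ((1 + r ^ 2) * y 0 ^ 2 + v 0 ^ 2) * Real.exp (-M t) := by
    intro r t y v hr hrR ht hmode
    have h1 := crude r T y v hr hrR ⟨hT, le_rfl⟩ (hmode.mono le_rfl ht)
    have h2 := hst.energy_le_of_le (hmode.mono hT le_rfl) hr hrR ht (J := J) (W := W)
      (hJ.mono fun s hs => hT.trans hs.1) (fun s hs => hJ' s (hT.trans_lt hs.1)) (fun s hs => by
        have e1 := hJΘ s t (hT.trans hs.1) hs.2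
        have e2 := hΘ_mono.monotoneOn self_mem_Ici (hT.trans hs.1) (hT.trans hs.1)
        calc r * (J t - J s) ≤ r * (Θ 0)⁻¹ := by
              gcongr
              exact e1.trans (by gcongr)
          _ ≤ _ := by rw [hW]; gcongr) (by positivity)
    calc _ ≤ A₃ * Real.exp (-(M t - M T)) * (A₂ *
        ((1 + r ^ 2) * y 0 ^ 2 + v 0 ^ 2) * Real.exp (-M T)) := h2.trans (by gcongr)
      _ = A₃ * A₂ * ((1 + r ^ 2) * y 0 ^ 2 + v 0 ^ 2) *
          (Real.exp (-(M t - M T)) * Real.exp (-M T)) := by ring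
      _ = _ := by rw [← Real.exp_add]; ring_nf
  have hA₂0 : 0 < A₂ := by positivity
  have hA₁0 : 0 < A₁ := by positivity
  set A₄ : ℝ := 3 * K ^ 4 * Real.exp 1 with hA₄
  have hA₄0 : 0 < A₄ := by positivity
  -- The losses on the two sides of the zone boundary add up: C₀C₂ρ(r) before it and 6KNρ(r) after
  -- it.
  set κ : ℝ := (C₀ * C₂ + 6 * K * N + 1) / 2 with hκ
  set C : ℝ := A₁ + (1 + R ^ 2) * A₂ + A₃ * A₂ + A₄ * A₁ with hC
  have hC₀₂ : 0 ≤ C₀ * C₂ := by positivity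
  refine ⟨κ, by positivity, C, by positivity, ?_⟩
  intro r t y v hr ht hmode
  have hρr := hρ.pos r hr
  set D := (1 + r ^ 2) * y 0 ^ 2 + v 0 ^ 2 with hD
  have hD0 : 0 ≤ D := by positivity
  have hκ1 : 1 ≤ Real.exp (2 * κ * ρ r) := Real.one_le_exp (by positivity)
  have hκ2 : Real.exp (C₀ * C₂ * ρ r) ≤ Real.exp (2 * κ * ρ r) := by
    have h1 : C₀ * C₂ ≤ 2 * κ := by rw [hκ]; nlinarith [mul_pos hK0 hN0]
    exact Real.exp_le_exp.2 (mul_le_mul_of_nonneg_right h1 hρr.le)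
  have fin : ∀ A, A ≤ C → ∀ e, e ≤ Real.exp (2 * κ * ρ r) → 0 ≤ e →
      A * e * D * Real.exp (-M t) ≤ C * Real.exp (2 * κ * ρ r) * D * Real.exp (-M t) := by
    intro A hA e he he0
    have hC0 : 0 < C := by positivity
    gcongr
  have p1 : 0 < (1 + R ^ 2) * A₂ := by positivity
  have p2 : 0 < A₃ * A₂ := by positivity
  have p3 : 0 < A₄ * A₁ := by positivity
  rcases le_or_gt (Θ t) (zeta ρ (r / N)) with hΘt | hΘt
  · exact (hyper r t y v hr ht hΘt hmode).trans (fin A₁ (by linarith) _ hκ2 (Real.exp_pos _).le)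
  rcases le_total t T with htT | htT
  · have hrR := hsmall r hr (hΘt.le.trans (hΘ_mono.monotoneOn ht hT htT))
    have h1 := crude r t y v hr hrR ⟨ht, htT⟩ hmode
    have h2 : r ^ 2 * y t ^ 2 + v t ^ 2 ≤ (1 + R ^ 2) * (y t ^ 2 + v t ^ 2) := by
      have h3 : r ^ 2 ≤ R ^ 2 := by gcongr
      nlinarith [mul_le_mul_of_nonneg_right h3 (sq_nonneg (y t)), sq_nonneg (y t),
        mul_nonneg (sq_nonneg R) (sq_nonneg (v t))]
    refine (h2.trans (mul_le_mul_of_nonneg_left h1 (by positivity))).trans ?_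
    refine le_trans (le_of_eq ?_) (fin ((1 + R ^ 2) * A₂) (by linarith) 1 hκ1 zero_le_one)
    ring
  rcases le_or_gt (zeta ρ (r / N)) (Θ T) with hΘT | hΘT
  · refine (low r t y v hr (hsmall r hr hΘT) htT hmode).trans ?_
    refine le_trans (le_of_eq ?_) (fin (A₃ * A₂) (by linarith) 1 hκ1 zero_le_one)
    ring
  -- the zone boundary lies between `T` and `t`
  obtain ⟨τ, hτ, hΘτ⟩ := intermediate_value_Icc htT (hΘ_cont.mono fun s hs => hT.trans hs.1)
    ⟨hΘT.le, hΘt.le⟩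
  have hτ0 : 0 ≤ τ := hT.trans hτ.1
  have h1 := hyper r τ y v hr hτ0 hΘτ.le (hmode.mono le_rfl hτ.2)
  have hgτ : g τ = r / N := hζ.injOn (hg0 τ hτ0).le (mem_Ici.2 (by positivity))
    ((hgζ τ hτ0).trans hΘτ)
  have hrN : 0 < r / N := hgτ ▸ hg0 τ hτ0
  have hr0 : 0 < r := by rwa [lt_div_iff₀ hN0, zero_mul] at hrN
  -- Thus r(1+τ) ≥ 1, and a mode that crosses the boundary after T goes directly to the estimate
  -- with μ ≤ r.
  have hr1 : 1 ≤ r := by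
    have e1 : g 0 ≤ r / N := by
      refine (hζ.le_iff_le (hg0 0 le_rfl).le (mem_Ici.2 (by positivity))).1 ?_
      rw [hgζ 0 le_rfl, ← hΘτ]
      exact hΘ_mono.monotoneOn self_mem_Ici hτ0 hτ0
    rw [le_div_iff₀ hN0] at e1
    have e2 := hg0 0 le_rfl
    rw [inv_le_iff_one_le_mul₀ e2] at hNg
    linarith
  have h2 := hst.energy_le (hmode.mono hτ0 le_rfl) hr0 hτ.1 hτ.2 (by nlinarith) (J := J)
    (hJ.mono fun s hs => hτ0.trans hs.1) (fun s hs => hJ' s (hτ0.trans_lt hs.1))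
  have h3 : r * (J t - J τ) ≤ N * ρ r := by
    have e1 := hJΘ τ t hτ0 hτ.2
    rw [hΘτ] at e1
    have e2 := hρ.pos (r / N) hrN.le
    calc r * (J t - J τ) ≤ r * (zeta ρ (r / N))⁻¹ := by gcongr
      _ = N * ρ (r / N) := by rw [zeta]; field_simp
      _ ≤ _ := by gcongr; exact hρN r hr
  have h4 : Real.exp (6 * K * (r * (J t - J τ))) * Real.exp (C₀ * C₂ * ρ r) ≤
      Real.exp (2 * κ * ρ r) := by
    rw [← Real.exp_add]
    refine Real.exp_le_exp.2 ?_
    have : 6 * K * (r * (J t - J τ)) ≤ 6 * K * (N * ρ r) := by gcongr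
    rw [hκ]
    nlinarith
  calc _ ≤ A₄ * Real.exp (6 * K * (r * (J t - J τ))) * Real.exp (-(M t - M τ)) *
        (A₁ * Real.exp (C₀ * C₂ * ρ r) * D * Real.exp (-M τ)) := h2.trans (by gcongr)
    _ = A₄ * A₁ * (Real.exp (6 * K * (r * (J t - J τ))) * Real.exp (C₀ * C₂ * ρ r)) * D *
        (Real.exp (-(M t - M τ)) * Real.exp (-M τ)) := by ring
    _ = A₄ * A₁ * (Real.exp (6 * K * (r * (J t - J τ))) * Real.exp (C₀ * C₂ * ρ r)) * D *
        Real.exp (-M t) := by rw [← Real.exp_add (-(M t - M τ))]; ring_nf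
    _ ≤ _ := fin (A₄ * A₁) (by linarith) _ h4 (by positivity)

/-! ### Linear differential equations in Banach spaces. -/

open scoped NNReal BoundedContinuousFunction

section LinearODE

variable {F : Type*} [NormedAddCommGroup F] [NormedSpace ℝ F]

theorem abs_clamp_sub_le (L s t : ℝ) :
    |max 0 (min 1 (L - s)) - max 0 (min 1 (L - t))| ≤ |s - t| := by
  rw [max_comm 0, max_comm 0]
  refine (abs_max_sub_max_le_abs _ _ _).trans ?_
  have := abs_min_sub_min_le_max 1 (L - s) 1 (L - t)
  simp only [sub_self, abs_zero] at this
  refine this.trans ?_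
  rw [show L - s - (L - t) = -(s - t) by ring, abs_neg]
  exact max_le (abs_nonneg _) le_rfl

/-- Linear non-autonomous differential equations in Banach spaces have global solutions. -/
theorem exists_hasDerivWithinAt_linear [CompleteSpace F] {A : ℝ → F →L[ℝ] F} {T : ℝ} (hT : 0 ≤ T)
    (hA : ContinuousOn A (Icc 0 T)) (x₀ : F) :
    ∃ y : ℝ → F, y 0 = x₀ ∧ ∀ t ∈ Icc 0 T, HasDerivWithinAt y (A t (y t)) (Icc 0 T) t := by
  obtain ⟨K, hK⟩ := (isCompact_Icc (a := (0 : ℝ)) (b := T)).exists_bound_of_continuousOn hA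
  have hK0 : 0 ≤ K := (norm_nonneg _).trans (hK 0 ⟨le_rfl, hT⟩)
  -- L exceeds the Gronwall bound by 1, so the cut-off θ equals 1 along the solution.
  set L : ℝ := ‖x₀‖ * Real.exp (K * T) + 1 with hL
  have hL0 : 0 ≤ L := by positivity
  set θ : F → ℝ := fun x => max 0 (min 1 (L - ‖x‖)) with hθ
  have hθ0 : ∀ x, 0 ≤ θ x := fun x => le_max_left _ _
  have hθ1 : ∀ x, θ x ≤ 1 := fun x => max_le zero_le_one (min_le_left _ _)
  have hθL : ∀ x, θ x * ‖x‖ ≤ L := fun x => by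
    rcases le_total ‖x‖ L with h | h
    · exact (mul_le_of_le_one_left (norm_nonneg x) (hθ1 x)).trans h
    · have : θ x = 0 := max_eq_left ((min_le_right _ _).trans (by linarith))
      rw [this, zero_mul]; exact hL0
  set f : ℝ → F → F := fun t x => θ x • A t x with hf
  have hfn : ∀ t ∈ Icc 0 T, ∀ x, ‖f t x‖ ≤ K * ‖x‖ := fun t ht x => by
    rw [hf, norm_smul, Real.norm_of_nonneg (hθ0 x)]
    calc _ ≤ 1 * (K * ‖x‖) := by
          gcongr
          · exact hθ1 x
          · exact (A t).le_of_opNorm_le (hK t ht) x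
      _ = _ := one_mul _
  have hfL : ∀ t ∈ Icc 0 T, ∀ x, ‖f t x‖ ≤ K * L := fun t ht x => by
    rw [hf, norm_smul, Real.norm_of_nonneg (hθ0 x)]
    calc _ ≤ θ x * (K * ‖x‖) := by
          gcongr
          · exact (A t).le_of_opNorm_le (hK t ht) x
      _ = K * (θ x * ‖x‖) := by ring
      _ ≤ _ := by gcongr; exact hθL x
  set a : ℝ := K * L * T with ha
  have ha0 : 0 ≤ a := by positivity
  -- The truncated field is bounded by KL everywhere, so a ball of radius a = KLT lets
  -- Picard–Lindelöf reach all of [0, T].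
  have hpl : IsPicardLindelof f (⟨0, le_rfl, hT⟩ : Icc 0 T) x₀ a.toNNReal 0 (K * L).toNNReal
      (K * (1 + (‖x₀‖ + a))).toNNReal := by
    refine ⟨fun t ht => ?_, fun x _ => ?_, fun t ht x _ => ?_, ?_⟩
    · refine LipschitzOnWith.of_dist_le_mul fun x hx y hy => ?_
      rw [Real.coe_toNNReal _ (by positivity), dist_eq_norm, dist_eq_norm]
      rw [Real.coe_toNNReal _ ha0, mem_closedBall_iff_norm] at hy
      have hyn : ‖y‖ ≤ ‖x₀‖ + a := by
        calc ‖y‖ = ‖x₀ + (y - x₀)‖ := by simp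
          _ ≤ _ := (norm_add_le _ _).trans (by gcongr)
      have e : f t x - f t y = θ x • A t (x - y) + (θ x - θ y) • A t y := by
        simp only [hf, map_sub, smul_sub, sub_smul]; abel
      have h1 : ‖θ x • A t (x - y)‖ ≤ 1 * (K * ‖x - y‖) := by
        rw [norm_smul, Real.norm_of_nonneg (hθ0 x)]
        gcongr
        · exact hθ1 x
        · exact (A t).le_of_opNorm_le (hK t ht) _
      have h2 : ‖(θ x - θ y) • A t y‖ ≤ ‖x - y‖ * (K * (‖x₀‖ + a)) := by
        rw [norm_smul, Real.norm_eq_abs]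
        gcongr
        · exact (abs_clamp_sub_le L _ _).trans (abs_norm_sub_norm_le x y)
        · exact ((A t).le_of_opNorm_le (hK t ht) y).trans (by gcongr)
      rw [e]
      calc _ ≤ 1 * (K * ‖x - y‖) + ‖x - y‖ * (K * (‖x₀‖ + a)) :=
            (norm_add_le _ _).trans (add_le_add h1 h2)
        _ = _ := by ring
    · exact (hA.clm_apply continuousOn_const).const_smul (θ x)
    · rw [Real.coe_toNNReal _ (by positivity)]; exact hfL t ht x
    · simp [Real.coe_toNNReal _ (by positivity : 0 ≤ K * L), ha, hT]
  obtain ⟨y, hy0, hy⟩ := hpl.exists_eq_forall_mem_Icc_hasDerivWithinAt₀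
  refine ⟨y, hy0, fun t ht => ?_⟩
  have hbound := norm_le_gronwallBound_of_norm_deriv_right_le (f := y) (f' := fun t => f t (y t))
    (δ := ‖x₀‖) (K := K) (ε := 0) (a := 0) (b := T) (fun t ht => (hy t ht).continuousWithinAt)
    (fun t ht => (hy t ⟨ht.1, ht.2.le⟩).mono_of_mem_nhdsWithin (Icc_mem_nhdsGE_of_mem ht))
    (by rw [← hy0]) (fun t ht => by simpa using hfn t ⟨ht.1, ht.2.le⟩ (y t)) t ht
  rw [gronwallBound_ε0, sub_zero] at hbound
  have hθt : θ (y t) = 1 := by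
    have : ‖x₀‖ * Real.exp (K * t) ≤ ‖x₀‖ * Real.exp (K * T) := by
      gcongr; exact ht.2
    have : min 1 (L - ‖y t‖) = 1 := min_eq_left (by rw [hL]; linarith)
    simp only [hθ, this]
    exact max_eq_right zero_le_one
  simpa only [hf, hθt, one_smul] using hy t ht

/-- The equation `p'' + a p + b p' = 0` in a Banach algebra. -/
theorem exists_fundamental_solution {𝓐 : Type*} [NormedRing 𝓐] [NormedAlgebra ℝ 𝓐]
    [CompleteSpace 𝓐] (a : 𝓐) {b : ℝ → ℝ} {T : ℝ} (hT : 0 ≤ T) (hb : ContinuousOn b (Icc 0 T))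
    (p₀ q₀ : 𝓐) :
    ∃ p q : ℝ → 𝓐, p 0 = p₀ ∧ q 0 = q₀ ∧ ∀ t ∈ Icc 0 T,
      HasDerivWithinAt p (q t) (Icc 0 T) t ∧
      HasDerivWithinAt q (-(a * p t) - b t • q t) (Icc 0 T) t := by
  let A₀ : 𝓐 × 𝓐 →L[ℝ] 𝓐 × 𝓐 := (ContinuousLinearMap.snd ℝ 𝓐 𝓐).prod
    (-((ContinuousLinearMap.mul ℝ 𝓐 a).comp (ContinuousLinearMap.fst ℝ 𝓐 𝓐)))
  let A₁ : 𝓐 × 𝓐 →L[ℝ] 𝓐 × 𝓐 := (0 : 𝓐 × 𝓐 →L[ℝ] 𝓐).prod (-ContinuousLinearMap.snd ℝ 𝓐 𝓐)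
  obtain ⟨x, hx0, hx⟩ := exists_hasDerivWithinAt_linear (A := fun t => A₀ + b t • A₁) hT
    (continuousOn_const.add (hb.smul continuousOn_const)) (p₀, q₀)
  refine ⟨fun t => (x t).1, fun t => (x t).2, by simp [hx0], by simp [hx0], fun t ht => ⟨?_, ?_⟩⟩
  · have := (ContinuousLinearMap.fst ℝ 𝓐 𝓐).hasFDerivAt.comp_hasDerivWithinAt t (hx t ht)
    convert! this using 1
    simp [A₀, A₁]
  · have := (ContinuousLinearMap.snd ℝ 𝓐 𝓐).hasFDerivAt.comp_hasDerivWithinAt t (hx t ht)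
    convert! this using 1
    simp [A₀, A₁, sub_eq_add_neg]

/-- Uniqueness for `w'' + A w + b w' = 0`. -/
theorem eq_zero_of_second_order_linear {A : F →L[ℝ] F} {b : ℝ → ℝ} {T : ℝ}
    (hb : ContinuousOn b (Icc 0 T)) {w z : ℝ → F} (hw0 : w 0 = 0) (hz0 : z 0 = 0)
    (hw : ∀ t ∈ Icc 0 T, HasDerivWithinAt w (z t) (Icc 0 T) t)
    (hz : ∀ t ∈ Icc 0 T, HasDerivWithinAt z (-(A (w t)) - b t • z t) (Icc 0 T) t) :
    ∀ t ∈ Icc 0 T, w t = 0 ∧ z t = 0 := by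
  obtain ⟨B, hB⟩ := (isCompact_Icc (a := (0 : ℝ)) (b := T)).exists_bound_of_continuousOn hb
  have h := eq_zero_of_abs_deriv_le_mul_abs_self_of_eq_zero_right
    (f := fun t => (w t, z t)) (f' := fun t => (z t, -(A (w t)) - b t • z t))
    (K := 1 + ‖A‖ + B) (a := 0) (b := T)
    (fun t ht => ((hw t ht).prodMk (hz t ht)).continuousWithinAt)
    (fun t ht => ((hw t ⟨ht.1, ht.2.le⟩).prodMk (hz t ⟨ht.1, ht.2.le⟩)).mono_of_mem_nhdsWithin
      (Icc_mem_nhdsGE_of_mem ht)) (by simp [hw0, hz0]) (fun t ht => by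
      have h1 : ‖w t‖ ≤ ‖(w t, z t)‖ := le_max_left _ _
      have h2 : ‖z t‖ ≤ ‖(w t, z t)‖ := le_max_right _ _
      have hBt := hB t ⟨ht.1, ht.2.le⟩
      have hB0 : 0 ≤ B := (norm_nonneg _).trans hBt
      have hn := norm_nonneg (w t, z t)
      refine max_le ?_ ?_
      · nlinarith [norm_nonneg A, mul_nonneg (norm_nonneg A) hn, mul_nonneg hB0 hn]
      · calc _ ≤ ‖-(A (w t))‖ + ‖b t • z t‖ := norm_sub_le _ _
          _ ≤ ‖A‖ * ‖(w t, z t)‖ + B * ‖(w t, z t)‖ := by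
            rw [norm_neg, norm_smul]
            gcongr
            exact (A.le_opNorm _).trans (by gcongr)
          _ ≤ _ := by nlinarith)
  intro t ht
  have := h t ht
  simpa [Prod.ext_iff] using this

end LinearODE

/-! ### Bounded continuous multipliers on L². -/

section Multiplication

variable {X : Type*} [TopologicalSpace X] [MeasurableSpace X] [BorelSpace X]
  (ν : Measure X)

/-- Bounded continuous functions as elements of `L^∞`. -/
noncomputable def toLinfty : (X →ᵇ ℝ) →L[ℝ] Lp ℝ ∞ ν :=
  LinearMap.mkContinuous
    { toFun := fun g => g.memLp_top.toLp g
      map_add' := fun _ _ => rfl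
      map_smul' := fun _ _ => rfl } 1 fun g => by
    rw [one_mul]
    refine (Lp.norm_toLp g g.memLp_top).trans_le ?_
    refine ENNReal.toReal_le_of_le_ofReal (norm_nonneg _) ?_
    rw [eLpNorm_exponent_top]
    exact eLpNormEssSup_le_of_ae_bound (ae_of_all _ fun x => g.norm_coe_le_norm x)

/-- Multiplication of `L²` functions by bounded continuous functions. -/
noncomputable def mulL2 : (X →ᵇ ℝ) →L[ℝ] Lp ℂ 2 ν →L[ℝ] Lp ℂ 2 ν :=
  ((ContinuousLinearMap.lsmul ℝ ℝ : ℝ →L[ℝ] ℂ →L[ℝ] ℂ).holderL ν ∞ 2 2).comp (toLinfty ν)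

theorem coeFn_mulL2 (g : X →ᵇ ℝ) (f : Lp ℂ 2 ν) :
    mulL2 ν g f =ᵐ[ν] fun x => (g x : ℂ) * f x := by
  have h1 := (ContinuousLinearMap.lsmul ℝ ℝ : ℝ →L[ℝ] ℂ →L[ℝ] ℂ).coeFn_holder
    (r := 2) (toLinfty ν g) f
  have h2 : toLinfty ν g =ᵐ[ν] g := MemLp.coeFn_toLp g.memLp_top
  filter_upwards [h1, h2] with x hx1 hx2
  refine hx1.trans ?_
  simp [hx2]

theorem mulL2_mul (g h : X →ᵇ ℝ) (f : Lp ℂ 2 ν) :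
    mulL2 ν (g * h) f = mulL2 ν g (mulL2 ν h f) := by
  apply Lp.ext
  filter_upwards [coeFn_mulL2 ν (g * h) f, coeFn_mulL2 ν g (mulL2 ν h f), coeFn_mulL2 ν h f]
    with x h1 h2 h3
  rw [h1, h2, h3]
  simp [mul_assoc]

theorem mulL2_one (f : Lp ℂ 2 ν) : mulL2 ν 1 f = f := by
  apply Lp.ext
  filter_upwards [coeFn_mulL2 ν 1 f] with x h1
  simp [h1]

theorem mulL2_comm (g h : X →ᵇ ℝ) (f : Lp ℂ 2 ν) :
    mulL2 ν g (mulL2 ν h f) = mulL2 ν h (mulL2 ν g f) := by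
  rw [← mulL2_mul, ← mulL2_mul, mul_comm]

/-- Solutions of `w'' + a w + b w' = 0` in `L²`, with `a` a bounded multiplier, are given by the
fundamental solution. -/
theorem eq_mulL2_of_second_order {a : X →ᵇ ℝ} {b : ℝ → ℝ} {T : ℝ} (hT : 0 ≤ T)
    (hb : ContinuousOn b (Icc 0 T)) {w z : ℝ → Lp ℂ 2 ν}
    (hw : ∀ t ∈ Icc 0 T, HasDerivWithinAt w (z t) (Icc 0 T) t)
    (hz : ∀ t ∈ Icc 0 T, HasDerivWithinAt z (-(mulL2 ν a (w t)) - b t • z t) (Icc 0 T) t) :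
    ∃ p q P Q : ℝ → X →ᵇ ℝ, p 0 = 1 ∧ q 0 = 0 ∧ P 0 = 0 ∧ Q 0 = 1 ∧
      (∀ t ∈ Icc 0 T, HasDerivWithinAt p (q t) (Icc 0 T) t ∧
        HasDerivWithinAt q (-(a * p t) - b t • q t) (Icc 0 T) t) ∧
      (∀ t ∈ Icc 0 T, HasDerivWithinAt P (Q t) (Icc 0 T) t ∧
        HasDerivWithinAt Q (-(a * P t) - b t • Q t) (Icc 0 T) t) ∧
      ∀ t ∈ Icc 0 T, w t = mulL2 ν (p t) (w 0) + mulL2 ν (P t) (z 0) ∧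
        z t = mulL2 ν (q t) (w 0) + mulL2 ν (Q t) (z 0) := by
  -- Solving in the Banach algebra of bounded continuous functions treats all frequencies at once
  -- and gives values at every point, so no exceptional null set depends on t.
  obtain ⟨p, q, hp0, hq0, hpq⟩ := exists_fundamental_solution a hT hb 1 0
  obtain ⟨P, Q, hP0, hQ0, hPQ⟩ := exists_fundamental_solution a hT hb 0 1
  refine ⟨p, q, P, Q, hp0, hq0, hP0, hQ0, hpq, hPQ, ?_⟩
  have hap : ∀ {g : ℝ → X →ᵇ ℝ} {g' : X →ᵇ ℝ} {t : ℝ} (f : Lp ℂ 2 ν),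
      HasDerivWithinAt g g' (Icc 0 T) t →
      HasDerivWithinAt (fun t => mulL2 ν (g t) f) (mulL2 ν g' f) (Icc 0 T) t := fun f hg =>
    (((mulL2 ν).flip f).hasFDerivAt.comp_hasDerivWithinAt _ hg)
  have key := eq_zero_of_second_order_linear (A := mulL2 ν a) hb
    (w := fun t => w t - (mulL2 ν (p t) (w 0) + mulL2 ν (P t) (z 0)))
    (z := fun t => z t - (mulL2 ν (q t) (w 0) + mulL2 ν (Q t) (z 0)))
    (by simp [hp0, hP0, mulL2_one]) (by simp [hq0, hQ0, mulL2_one])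
    (fun t ht => (hw t ht).sub ((hap _ (hpq t ht).1).add (hap _ (hPQ t ht).1)))
    (fun t ht => by
      refine ((hz t ht).sub ((hap _ (hpq t ht).2).add (hap _ (hPQ t ht).2))).congr_deriv ?_
      simp only [map_sub, map_neg, map_smul, sub_apply,
        neg_apply, smul_apply, mulL2_mul, map_add,
        smul_sub, smul_add]
      abel)
  exact fun t ht => ⟨sub_eq_zero.1 (key t ht).1, sub_eq_zero.1 (key t ht).2⟩

end Multiplication

/-! ### From the weak wave equation to the mode equation. -/

open scoped NNReal BoundedContinuousFunction ContDiff

variable {n : ℕ}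

theorem toDist_apply (f : L2 n) (ψ : 𝓢(EuclideanSpace ℝ (Fin n), ℂ)) :
    toDist f ψ = ∫ x, ψ x * f x := by
  simp [toDist, Lp.toTemperedDistribution_apply]

/-- The pairing of `L²` functions with a test function. -/
noncomputable def pairing (ψ : 𝓢(EuclideanSpace ℝ (Fin n), ℂ)) : L2 n →L[ℂ] ℂ :=
  (ContinuousLinearMap.lsmul ℂ ℂ : ℂ →L[ℂ] ℂ →L[ℂ] ℂ).lpPairing volume 2 2 (ψ.toLp 2)

theorem pairing_apply (ψ : 𝓢(EuclideanSpace ℝ (Fin n), ℂ)) (f : L2 n) :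
    pairing ψ f = toDist f ψ := by
  rw [pairing, ContinuousLinearMap.lpPairing_eq_integral, toDist_apply]
  refine integral_congr_ae ?_
  filter_upwards [ψ.coeFn_toLp 2 volume] with x hx
  simp [hx]

theorem ae_eq_zero_of_pairing_eq_zero {f : L2 n} {U : Set (EuclideanSpace ℝ (Fin n))}
    (hU : IsOpen U) (h : ∀ ψ : 𝓢(EuclideanSpace ℝ (Fin n), ℂ), tsupport ψ ⊆ U → pairing ψ f = 0) :
    ∀ᵐ x, x ∈ U → f x = 0 := by
  refine hU.ae_eq_zero_of_integral_contDiff_smul_eq_zero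
    (((Lp.memLp f).locallyIntegrable one_le_two).locallyIntegrableOn U) fun g hg hgc hgU => ?_
  have hg₁ : HasCompactSupport (Complex.ofRealCLM ∘ g) := hgc.comp_left rfl
  have hg₂ : ContDiff ℝ ∞ (Complex.ofRealCLM ∘ g) := by fun_prop
  have := h (hg₁.toSchwartzMap hg₂) ((tsupport_comp_subset (g := Complex.ofRealCLM) (map_zero _) g).trans hgU)
  rw [pairing_apply, toDist_apply] at this
  simpa using this

theorem toDist_fourier (f : L2 n) : toDist (𝓕 f) = 𝓕 (toDist f) :=
  (Lp.fourier_toTemperedDistribution_eq f).symm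

theorem laplacian_fourier (f : L2 n) (ψ : 𝓢(EuclideanSpace ℝ (Fin n), ℂ)) :
    (Δ (toDist f)) (𝓕 ψ) = -(2 * (Real.pi : ℂ)) ^ 2 * pairing
      (SchwartzMap.smulLeftCLM ℂ (fun x : EuclideanSpace ℝ (Fin n) => Complex.ofReal (‖x‖ ^ 2)) ψ)
        (𝓕 f) := by
  rw [TemperedDistribution.laplacian_eq_fourierMultiplierCLM, pairing_apply, toDist_fourier]
  simp

/-- The Fourier transform on `L²` as a real linear map. -/
noncomputable def fourierL (n : ℕ) : L2 n →L[ℝ] L2 n :=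
  (Lp.fourierTransformₗᵢ (EuclideanSpace ℝ (Fin n)) ℂ).toContinuousLinearEquiv.toContinuousLinearMap.restrictScalars ℝ

section Solution

variable {b : ℝ → ℝ} {u₀ u₁ : L2 n} {u : ℝ → L2 n}

theorem IsSolution.hasDerivWithinAt (h : IsSolution b u₀ u₁ u) {t : ℝ} (ht : 0 ≤ t) :
    HasDerivWithinAt (fun s => 𝓕 (u s)) (𝓕 (timeDeriv u t)) (Ici 0) t :=
  (fourierL n).hasFDerivAt.comp_hasDerivWithinAt t
    ((h.contDiffOn.differentiableOn one_ne_zero t ht).hasDerivWithinAt)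

theorem IsSolution.continuousOn_timeDeriv (h : IsSolution b u₀ u₁ u) :
    ContinuousOn (fun s => 𝓕 (timeDeriv u s)) (Ici 0) :=
  (fourierL n).continuous.comp_continuousOn
    (h.contDiffOn.continuousOn_derivWithin (uniqueDiffOn_Ici 0) le_rfl)

theorem IsSolution.hasDerivAt_pairing (h : IsSolution b u₀ u₁ u)
    (ψ : 𝓢(EuclideanSpace ℝ (Fin n), ℂ)) {t : ℝ} (ht : 0 < t) :
    HasDerivAt (fun s => pairing ψ (𝓕 (timeDeriv u s)))
      (-(2 * (Real.pi : ℂ)) ^ 2 * pairing (SchwartzMap.smulLeftCLM ℂ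
        (fun x : EuclideanSpace ℝ (Fin n) => Complex.ofReal (‖x‖ ^ 2)) ψ) (𝓕 (u t)) -
        b t * pairing ψ (𝓕 (timeDeriv u t))) t := by
  have := h.equation (𝓕 ψ) t ht
  rw [laplacian_fourier] at this
  simpa only [pairing_apply, toDist_fourier, TemperedDistribution.fourier_apply] using this

end Solution

/-- The symbol `|2πη|²` of `-Δ`, truncated at height `R²`. -/
noncomputable def truncSymbol (n : ℕ) (R : ℝ) : EuclideanSpace ℝ (Fin n) →ᵇ ℝ :=
  BoundedContinuousFunction.ofNormedAddCommGroup
    (fun η => (max 0 (min (2 * Real.pi * ‖η‖) R)) ^ 2) (by fun_prop) (R ^ 2) fun η => by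
      rw [Real.norm_of_nonneg (sq_nonneg _)]
      rcases le_total 0 R with h | h
      · gcongr
        exact max_le h (min_le_right _ _)
      · rw [max_eq_left ((min_le_right _ _).trans h)]
        simpa using sq_nonneg R

/-- A cut-off function, positive exactly where `|2πη| < R`. -/
noncomputable def freqCutoff (n : ℕ) (R : ℝ) : EuclideanSpace ℝ (Fin n) →ᵇ ℝ :=
  BoundedContinuousFunction.ofNormedAddCommGroup
    (fun η => max 0 (R - 2 * Real.pi * ‖η‖)) (by fun_prop) |R| fun η => by
      have : 0 ≤ 2 * Real.pi * ‖η‖ := by positivity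
      rw [Real.norm_of_nonneg (le_max_left _ _)]
      exact max_le (abs_nonneg R) (by linarith [le_abs_self R])

theorem truncSymbol_apply {R : ℝ} {η : EuclideanSpace ℝ (Fin n)} (h : 2 * Real.pi * ‖η‖ < R) :
    truncSymbol n R η = (2 * Real.pi * ‖η‖) ^ 2 := by
  have : 0 ≤ 2 * Real.pi * ‖η‖ := by positivity
  change (max 0 (min (2 * Real.pi * ‖η‖) R)) ^ 2 = _
  rw [min_eq_left h.le, max_eq_right this]

theorem freqCutoff_pos {R : ℝ} {η : EuclideanSpace ℝ (Fin n)} (h : 2 * Real.pi * ‖η‖ < R) :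
    0 < freqCutoff n R η :=
  lt_max_of_lt_right (sub_pos.2 h)

theorem freqCutoff_eq_zero {R : ℝ} {η : EuclideanSpace ℝ (Fin n)} (h : R ≤ 2 * Real.pi * ‖η‖) :
    freqCutoff n R η = 0 :=
  max_eq_left (sub_nonpos.2 h)

/-- The truncated symbol differs from |2πη|² only off the support of ψ. This replaces an unbounded
multiplier, for which |η|² 𝓕f need not lie in L², by a bounded one. -/
theorem pairing_truncSymbol {R : ℝ} {ψ : 𝓢(EuclideanSpace ℝ (Fin n), ℂ)}
    (hψ : tsupport ψ ⊆ {η | 2 * Real.pi * ‖η‖ < R}) (f : L2 n) :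
    (2 * (Real.pi : ℂ)) ^ 2 * pairing (SchwartzMap.smulLeftCLM ℂ
        (fun x : EuclideanSpace ℝ (Fin n) => Complex.ofReal (‖x‖ ^ 2)) ψ) f =
      pairing ψ (mulL2 volume (truncSymbol n R) f) := by
  rw [pairing_apply, pairing_apply, toDist_apply, toDist_apply, ← integral_const_mul]
  refine integral_congr_ae ?_
  filter_upwards [coeFn_mulL2 volume (truncSymbol n R) f] with η hη
  rw [hη, SchwartzMap.smulLeftCLM_apply_apply (by fun_prop)]
  by_cases h : η ∈ tsupport ψ
  · rw [truncSymbol_apply (hψ h)]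
    push_cast
    simp only [smul_eq_mul]
    ring
  · simp [image_eq_zero_of_notMem_tsupport h]

/-- The pairs (p, q) and (P, Q) are the modes with data (1, 0) and (0, 1). The factor 2 comes from
(a + b)² ≤ 2(a² + b²). -/
theorem norm_sq_superposition_le {r G p P q Q : ℝ} {x y : ℂ}
    (h₁ : r ^ 2 * p ^ 2 + q ^ 2 ≤ G * ((1 + r ^ 2) * 1 ^ 2 + 0 ^ 2))
    (h₂ : r ^ 2 * P ^ 2 + Q ^ 2 ≤ G * ((1 + r ^ 2) * 0 ^ 2 + 1 ^ 2)) :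
    r ^ 2 * ‖(p : ℂ) * x + P * y‖ ^ 2 + ‖(q : ℂ) * x + Q * y‖ ^ 2 ≤
      2 * G * ((1 + r ^ 2) * ‖x‖ ^ 2 + ‖y‖ ^ 2) := by
  have hsq : ∀ c d : ℝ, ‖(c : ℂ) * x + d * y‖ ^ 2 ≤ 2 * (c ^ 2 * ‖x‖ ^ 2 + d ^ 2 * ‖y‖ ^ 2) := by
    intro c d
    have e1 : ‖(c : ℂ) * x + d * y‖ ≤ |c| * ‖x‖ + |d| * ‖y‖ := by
      refine (norm_add_le _ _).trans_eq ?_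
      simp
    calc _ ≤ (|c| * ‖x‖ + |d| * ‖y‖) ^ 2 := by gcongr
      _ ≤ 2 * ((|c| * ‖x‖) ^ 2 + (|d| * ‖y‖) ^ 2) := add_sq_le
      _ = _ := by rw [mul_pow, mul_pow, sq_abs, sq_abs]
  have n1 := mul_le_mul_of_nonneg_left (hsq p P) (sq_nonneg r)
  have n2 := hsq q Q
  have n3 := mul_le_mul_of_nonneg_right h₁ (sq_nonneg ‖x‖)
  have n4 := mul_le_mul_of_nonneg_right h₂ (sq_nonneg ‖y‖)
  linarith

section Solution

variable {b : ℝ → ℝ} {u₀ u₁ : L2 n} {u : ℝ → L2 n}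

/-- A weak differential equation `z' = -H` on an open set, in integrated form. -/
theorem ae_eq_zero_of_weak_deriv {z H : ℝ → L2 n} (hz : ContinuousOn z (Ici 0)) (hH : Continuous H)
    {U : Set (EuclideanSpace ℝ (Fin n))} (hU : IsOpen U)
    (hweak : ∀ ψ : 𝓢(EuclideanSpace ℝ (Fin n), ℂ), tsupport ψ ⊆ U → ∀ t, 0 < t →
      HasDerivAt (fun s => pairing ψ (z s)) (-(pairing ψ (H t))) t) {s : ℝ} (hs : 0 ≤ s) :
    ∀ᵐ η, η ∈ U → (z s - z 0 + ∫ x in (0 : ℝ)..s, H x) η = 0 := by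
  refine ae_eq_zero_of_pairing_eq_zero hU fun ψ hψ => ?_
  have hpc : Continuous (fun f => pairing ψ f) := (pairing ψ).continuous
  have hpd : ∀ x, HasDerivAt (fun s => pairing ψ (∫ x in (0 : ℝ)..s, H x))
      (pairing ψ (H x)) x := fun x =>
    ((pairing ψ).restrictScalars ℝ).hasFDerivAt.comp_hasDerivAt x
      (intervalIntegral.integral_hasDerivAt_right (hH.intervalIntegrable _ _)
        hH.aestronglyMeasurable.stronglyMeasurableAtFilter hH.continuousAt)
  -- The derivatives cancel, so the pairing of z + ∫H with ψ is constant in time.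
  have key := intervalIntegral.integral_eq_sub_of_hasDerivAt_of_le hs
    (f := fun s => pairing ψ (z s) + pairing ψ (∫ x in (0 : ℝ)..s, H x)) (f' := fun _ => 0)
    ((hpc.comp_continuousOn (hz.mono fun x hx => hx.1)).add
      fun x _ => (hpd x).continuousAt.continuousWithinAt)
    (fun x hx => ((hweak ψ hψ x hx.1).add (hpd x)).congr_deriv (by ring)) (by simp)
  simp only [intervalIntegral.integral_zero, intervalIntegral.integral_same, map_zero,
    add_zero] at key
  rw [map_add, map_sub]
  linear_combination -key

theorem mulL2_freqCutoff_eq_zero {R : ℝ} {f : L2 n}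
    (h : ∀ᵐ η, η ∈ {η : EuclideanSpace ℝ (Fin n) | 2 * Real.pi * ‖η‖ < R} → f η = 0) :
    mulL2 volume (freqCutoff n R) f = 0 := by
  apply Lp.ext
  filter_upwards [h, coeFn_mulL2 volume (freqCutoff n R) f,
    Lp.coeFn_zero ℂ 2 (volume : Measure (EuclideanSpace ℝ (Fin n)))] with η h1 h2 h3
  rw [h2, h3]
  rcases lt_or_ge (2 * Real.pi * ‖η‖) R with hη | hη
  · rw [h1 hη]; simp
  · rw [freqCutoff_eq_zero hη]; simp

/-- The integrated equation is known only after applying A, here the frequency cut-off. It makes A ∘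
z differentiable in norm although z itself need not be. -/
theorem hasDerivWithinAt_of_integral_eq {V : Type*} [NormedAddCommGroup V] [NormedSpace ℝ V]
    [CompleteSpace V] {z H : ℝ → V} (A : V →L[ℝ] V)
    (hH : Continuous H) {T t : ℝ} (ht : t ∈ Icc 0 T)
    (h : ∀ s ∈ Icc 0 T, A (z s - z 0 + ∫ x in (0 : ℝ)..s, H x) = 0) :
    HasDerivWithinAt (fun s => A (z s)) (-(A (H t))) (Icc 0 T) t := by
  have hd : HasDerivAt (fun s => ∫ x in (0 : ℝ)..s, H x) (H t) t :=
    intervalIntegral.integral_hasDerivAt_right (hH.intervalIntegrable _ _)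
      hH.aestronglyMeasurable.stronglyMeasurableAtFilter hH.continuousAt
  have hd2 : HasDerivWithinAt (fun s => A (z 0) - A (∫ x in (0 : ℝ)..s, H x)) (-(A (H t)))
      (Icc 0 T) t :=
    ((A.hasFDerivAt.comp_hasDerivAt t hd).hasDerivWithinAt).const_sub _
  refine hd2.congr_of_mem (fun s hs => ?_) ht
  have := h s hs
  rw [map_add, map_sub] at this
  rw [← sub_eq_zero, ← this]
  abel

set_option maxHeartbeats 1000000 in
/-- The frequency localized solution solves an ordinary differential equation in `L²`. -/
theorem IsSolution.hasDerivWithinAt_cutoff (h : IsSolution b u₀ u₁ u)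
    (hb : ContinuousOn b (Ici 0)) (R T : ℝ) {t : ℝ} (ht : t ∈ Icc 0 T) :
    HasDerivWithinAt (fun s => mulL2 volume (freqCutoff n R) (𝓕 (timeDeriv u s)))
      (-(mulL2 volume (truncSymbol n R) (mulL2 volume (freqCutoff n R) (𝓕 (u t)))) -
        b t • mulL2 volume (freqCutoff n R) (𝓕 (timeDeriv u t))) (Icc 0 T) t := by
  -- Composition with max(s, 0) extends the integrand continuously to negative times.
  have hmax : Continuous fun s : ℝ => max s 0 := by fun_prop
  have hmem : ∀ s : ℝ, max s 0 ∈ Ici (0 : ℝ) := fun s => mem_Ici.2 (le_max_right _ _)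
  have hwc : ContinuousOn (fun s => (𝓕 (u s) : L2 n)) (Ici 0) := fun s hs =>
    (h.hasDerivWithinAt hs).continuousWithinAt
  have hzc := h.continuousOn_timeDeriv
  have hHc : Continuous fun s => mulL2 volume (truncSymbol n R) (𝓕 (u (max s 0))) +
      b (max s 0) • (𝓕 (timeDeriv u (max s 0)) : L2 n) :=
    ((mulL2 volume (truncSymbol n R)).continuous.comp (hwc.comp_continuous hmax hmem)).add
      ((hb.comp_continuous hmax hmem).smul (hzc.comp_continuous hmax hmem))
  have hU : IsOpen {η : EuclideanSpace ℝ (Fin n) | 2 * Real.pi * ‖η‖ < R} :=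
    isOpen_lt (by fun_prop) continuous_const
  have hd := hasDerivWithinAt_of_integral_eq (z := fun s => (𝓕 (timeDeriv u s) : L2 n))
    (mulL2 volume (freqCutoff n R)) hHc ht fun s hs => mulL2_freqCutoff_eq_zero
      (ae_eq_zero_of_weak_deriv hzc hHc hU (fun ψ hψ x hx => by
        refine (h.hasDerivAt_pairing ψ hx).congr_deriv ?_
        rw [neg_mul, pairing_truncSymbol hψ, max_eq_left hx.le, map_add]
        have : pairing ψ (b x • (𝓕 (timeDeriv u x) : L2 n)) =
            b x * pairing ψ (𝓕 (timeDeriv u x)) :=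
          (pairing ψ).map_smul_of_tower (b x) _
        rw [this]
        ring) hs.1)
  refine hd.congr_deriv ?_
  rw [max_eq_left ht.1, map_add, map_smul, mulL2_comm volume (freqCutoff n R)]
  abel

set_option maxHeartbeats 1000000 in
/-- Each Fourier mode of a solution obeys the bounds that hold for all solutions of the
corresponding ordinary differential equation. -/
theorem IsSolution.ae_mode_le (h : IsSolution b u₀ u₁ u) (hb : ContinuousOn b (Ici 0)) {t : ℝ}
    (ht : 0 ≤ t) {G : ℝ → ℝ}
    (hG : ∀ (r : ℝ) (y v : ℝ → ℝ), 0 ≤ r → IsModeOn b r 0 t y v →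
      r ^ 2 * y t ^ 2 + v t ^ 2 ≤ G r * ((1 + r ^ 2) * y 0 ^ 2 + v 0 ^ 2)) :
    ∀ᵐ η : EuclideanSpace ℝ (Fin n),
      (2 * Real.pi * ‖η‖) ^ 2 * ‖(𝓕 (u t) : L2 n) η‖ ^ 2 +
        ‖(𝓕 (timeDeriv u t) : L2 n) η‖ ^ 2 ≤ 2 * G (2 * Real.pi * ‖η‖) *
        ((1 + (2 * Real.pi * ‖η‖) ^ 2) * ‖(𝓕 u₀ : L2 n) η‖ ^ 2 + ‖(𝓕 u₁ : L2 n) η‖ ^ 2) := by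
  -- The multiplier argument needs bounded frequencies; countably many balls cover the space up to a
  -- null set.
  suffices H : ∀ k : ℕ, ∀ᵐ η : EuclideanSpace ℝ (Fin n), 2 * Real.pi * ‖η‖ < k →
      (2 * Real.pi * ‖η‖) ^ 2 * ‖(𝓕 (u t) : L2 n) η‖ ^ 2 +
        ‖(𝓕 (timeDeriv u t) : L2 n) η‖ ^ 2 ≤ 2 * G (2 * Real.pi * ‖η‖) *
        ((1 + (2 * Real.pi * ‖η‖) ^ 2) * ‖(𝓕 u₀ : L2 n) η‖ ^ 2 + ‖(𝓕 u₁ : L2 n) η‖ ^ 2) by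
    filter_upwards [ae_all_iff.2 H] with η hη
    obtain ⟨k, hk⟩ := exists_nat_gt (2 * Real.pi * ‖η‖)
    exact hη k hk
  intro k
  set χ := freqCutoff n k with hχ
  have hsub : Icc 0 t ⊆ Ici (0 : ℝ) := fun s hs => hs.1
  obtain ⟨p, q, P, Q, hp0, hq0, hP0, hQ0, hpq, hPQ, hrep⟩ := eq_mulL2_of_second_order volume
    (a := truncSymbol n k) ht (hb.mono hsub) (w := fun s => mulL2 volume χ (𝓕 (u s)))
    (z := fun s => mulL2 volume χ (𝓕 (timeDeriv u s)))
    (fun s hs => (mulL2 volume χ).hasFDerivAt.comp_hasDerivWithinAt s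
      ((h.hasDerivWithinAt hs.1).mono hsub))
    (fun s hs => h.hasDerivWithinAt_cutoff hb k t hs)
  obtain ⟨hw, hz⟩ := hrep t ⟨ht, le_rfl⟩
  simp only [h.init, h.init_deriv] at hw hz
  have hmode : ∀ {g g' : ℝ → EuclideanSpace ℝ (Fin n) →ᵇ ℝ} {η : EuclideanSpace ℝ (Fin n)},
      2 * Real.pi * ‖η‖ < k → (∀ s ∈ Icc 0 t, HasDerivWithinAt g (g' s) (Icc 0 t) s ∧
        HasDerivWithinAt g' (-(truncSymbol n k * g s) - b s • g' s) (Icc 0 t) s) →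
      IsModeOn b (2 * Real.pi * ‖η‖) 0 t (fun s => g s η) (fun s => g' s η) := by
    intro g g' η hη hg
    have e1 : ∀ s ∈ Icc 0 t, HasDerivWithinAt (fun s => g s η) (g' s η) (Icc 0 t) s := fun s hs =>
      (BoundedContinuousFunction.evalCLM ℝ (β := ℝ) η).hasFDerivAt.comp_hasDerivWithinAt s (hg s hs).1
    have e2 : ∀ s ∈ Icc 0 t, HasDerivWithinAt (fun s => g' s η)
        (-((2 * Real.pi * ‖η‖) ^ 2 * g s η) - b s * g' s η) (Icc 0 t) s := fun s hs => by
      refine ((BoundedContinuousFunction.evalCLM ℝ (β := ℝ) η).hasFDerivAt.comp_hasDerivWithinAt s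
        (hg s hs).2).congr_deriv ?_
      simp [truncSymbol_apply hη]
    exact ⟨fun s hs => (e1 s hs).continuousWithinAt, fun s hs => (e2 s hs).continuousWithinAt,
      fun s hs => (e1 s (Ioo_subset_Icc_self hs)).hasDerivAt (Icc_mem_nhds hs.1 hs.2),
      fun s hs => (e2 s (Ioo_subset_Icc_self hs)).hasDerivAt (Icc_mem_nhds hs.1 hs.2)⟩
  have hw' := Lp.ext_iff.1 hw
  have hz' := Lp.ext_iff.1 hz
  filter_upwards [hw', hz', coeFn_mulL2 volume χ (𝓕 (u t)), coeFn_mulL2 volume χ (𝓕 (timeDeriv u t)),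
    coeFn_mulL2 volume χ (𝓕 u₀), coeFn_mulL2 volume χ (𝓕 u₁),
    Lp.coeFn_add (mulL2 volume (p t) (mulL2 volume χ (𝓕 u₀)))
      (mulL2 volume (P t) (mulL2 volume χ (𝓕 u₁))),
    Lp.coeFn_add (mulL2 volume (q t) (mulL2 volume χ (𝓕 u₀)))
      (mulL2 volume (Q t) (mulL2 volume χ (𝓕 u₁))),
    coeFn_mulL2 volume (p t) (mulL2 volume χ (𝓕 u₀)),
    coeFn_mulL2 volume (P t) (mulL2 volume χ (𝓕 u₁)),
    coeFn_mulL2 volume (q t) (mulL2 volume χ (𝓕 u₀)),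
    coeFn_mulL2 volume (Q t) (mulL2 volume χ (𝓕 u₁))]
    with η h1 h2 h3 h4 h5 h6 h7 h8 h9 h10 h11 h12 hη
  -- Inside the ball the cut-off does not vanish and can be divided out.
  have hχ0 : (χ η : ℂ) ≠ 0 := by exact_mod_cast (freqCutoff_pos hη).ne'
  have ew : (𝓕 (u t) : L2 n) η = p t η * (𝓕 u₀ : L2 n) η + P t η * (𝓕 u₁ : L2 n) η := by
    rw [h3, h7, Pi.add_apply, h9, h10, h5, h6] at h1
    apply mul_left_cancel₀ hχ0
    rw [h1]; ring
  have ez : (𝓕 (timeDeriv u t) : L2 n) η = q t η * (𝓕 u₀ : L2 n) η + Q t η * (𝓕 u₁ : L2 n) η := by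
    rw [h4, h8, Pi.add_apply, h11, h12, h5, h6] at h2
    apply mul_left_cancel₀ hχ0
    rw [h2]; ring
  have hr0 : 0 ≤ 2 * Real.pi * ‖η‖ := mul_nonneg Real.two_pi_pos.le (norm_nonneg η)
  have m1 := hG _ _ _ hr0 (hmode hη hpq)
  have m2 := hG _ _ _ hr0 (hmode hη hPQ)
  simp only [hp0, hq0, hP0, hQ0] at m1 m2
  simp only [BoundedContinuousFunction.coe_one, BoundedContinuousFunction.coe_zero, Pi.one_apply,
    Pi.zero_apply] at m1 m2
  rw [ew, ez]
  exact norm_sq_superposition_le m1 m2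

end Solution

/-! ### Plancherel: from mode bounds to the energy. -/

open scoped ContDiff

variable {n : ℕ}

theorem MemH1.toDist_weakPartial {f : L2 n} (hf : MemH1 f) (j : Fin n) :
    ∂_{EuclideanSpace.single j (1 : ℝ)} (toDist f) = toDist (weakPartial j f) := by
  have h0 : TemperedDistribution.MemSobolev 0 2
      (∂_{EuclideanSpace.single j (1 : ℝ)} (toDist f)) := by
    simpa using TemperedDistribution.MemSobolev.lineDerivOp hf (m := EuclideanSpace.single j (1 : ℝ))
  have h : ∃ g : L2 n, ∂_{EuclideanSpace.single j (1 : ℝ)} (toDist f) = toDist g :=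
    TemperedDistribution.memSobolev_zero_iff.1 h0
  rw [weakPartial, dif_pos h]
  exact h.choose_spec

/-- The derivative becomes multiplication by 2πiη_j as a tempered distribution. Both sides are
locally integrable, so testing with smooth compactly supported functions gives equality almost
everywhere. -/
theorem MemH1.fourier_weakPartial {f : L2 n} (hf : MemH1 f) (j : Fin n) :
    ∀ᵐ η, (𝓕 (weakPartial j f) : L2 n) η =
      ((2 * Real.pi * η j : ℝ) : ℂ) • (Complex.I * (𝓕 f : L2 n) η) := by
  refine ae_eq_of_integral_contDiff_smul_eq ((Lp.memLp _).locallyIntegrable one_le_two) ?_ ?_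
  · have hc : Continuous fun η : EuclideanSpace ℝ (Fin n) => ((2 * Real.pi * η j : ℝ) : ℂ) := by
      fun_prop
    exact locallyIntegrableOn_univ.1 ((locallyIntegrableOn_univ.2
      (((Lp.memLp (𝓕 f : L2 n)).locallyIntegrable one_le_two).smul Complex.I)).continuousOn_smul
        isOpen_univ.isLocallyClosed hc.continuousOn)
  intro g hg hgc
  have hg₁ : HasCompactSupport (Complex.ofRealCLM ∘ g) := hgc.comp_left rfl
  have hg₂ : ContDiff ℝ ∞ (Complex.ofRealCLM ∘ g) := by fun_prop
  have h1 := congrArg (fun T => T (hg₁.toSchwartzMap hg₂)) ((toDist_fourier (weakPartial j f)).trans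
    ((congrArg 𝓕 (hf.toDist_weakPartial j)).symm.trans
      (TemperedDistribution.fourier_lineDerivOp_eq _ _)))
  rw [← toDist_fourier] at h1
  simp at h1
  calc _ = _ := by simpa using h1
    _ = _ := by
      rw [← integral_const_mul]
      refine integral_congr_ae (Eventually.of_forall fun η => ?_)
      have : Function.HasTemperateGrowth fun x : EuclideanSpace ℝ (Fin n) =>
        ((inner ℝ x (EuclideanSpace.single j 1) : ℝ) : ℂ) := by fun_prop
      simp only [SchwartzMap.smulLeftCLM_apply_apply this]
      simp [EuclideanSpace.inner_single_right]
      ring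

theorem sum_norm_sq_weakPartial {f : L2 n} (hf : MemH1 f) :
    ∀ᵐ η, ∑ j, ‖(𝓕 (weakPartial j f) : L2 n) η‖ ^ 2 =
      (2 * Real.pi * ‖η‖) ^ 2 * ‖(𝓕 f : L2 n) η‖ ^ 2 := by
  filter_upwards [ae_all_iff.2 fun j => hf.fourier_weakPartial j] with η hη
  simp only [hη, norm_smul, norm_mul, Complex.norm_I, Complex.norm_real, mul_pow, one_mul,
    Real.norm_eq_abs, sq_abs, EuclideanSpace.norm_sq_eq, ← Finset.sum_mul, ← Finset.mul_sum]

theorem ofReal_norm_sq (f : L2 n) :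
    ENNReal.ofReal (‖f‖ ^ 2) = ∫⁻ η, ENNReal.ofReal (‖(𝓕 f : L2 n) η‖ ^ 2) := by
  rw [← Lp.norm_fourier_eq, Lp.norm_def, ENNReal.ofReal_pow ENNReal.toReal_nonneg,
    ENNReal.ofReal_toReal (Lp.eLpNorm_ne_top _),
    eLpNorm_eq_lintegral_rpow_enorm_toReal two_ne_zero ENNReal.ofNat_ne_top]
  simp only [ENNReal.toReal_ofNat, ENNReal.rpow_ofNat]
  rw [← ENNReal.rpow_natCast, ← ENNReal.rpow_mul]
  norm_num

theorem lintegral_comp_smul (g : EuclideanSpace ℝ (Fin n) → ℝ≥0∞) {r : ℝ} (hr : 0 < r) :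
    ∫⁻ x, g (r • x) = ENNReal.ofReal ((r ^ n)⁻¹) * ∫⁻ x, g x := by
  have h := Measure.map_addHaar_smul (volume : Measure (EuclideanSpace ℝ (Fin n))) hr.ne'
  rw [finrank_euclideanSpace_fin, abs_of_pos (by positivity)] at h
  rw [← smul_eq_mul, ← lintegral_smul_measure, ← h]
  exact (lintegral_map_equiv g (Homeomorph.smulOfNeZero r hr.ne').toMeasurableEquiv).symm

/-- Under ξ = 2πη the Jacobian (2π)^n cancels the squared normalization of `fourierHat`. -/
theorem hNorm_sq (ρ : ℝ → ℝ) (κ : ℝ) (u₀ u₁ : L2 n) :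
    hNorm ρ κ u₀ u₁ ^ 2 = ∫⁻ η : EuclideanSpace ℝ (Fin n),
      ENNReal.ofReal (Real.exp (2 * κ * ρ (2 * Real.pi * ‖η‖)) *
        ((1 + (2 * Real.pi * ‖η‖) ^ 2) * ‖(𝓕 u₀ : L2 n) η‖ ^ 2 + ‖(𝓕 u₁ : L2 n) η‖ ^ 2)) := by
  have hπ : 0 < (2 * Real.pi) := Real.two_pi_pos
  have hc : ((2 * Real.pi) ^ (-(n : ℝ) / 2)) ^ 2 = ((2 * Real.pi) ^ n)⁻¹ := by
    rw [← Real.rpow_natCast, ← Real.rpow_mul hπ.le, ← Real.rpow_natCast, ← Real.rpow_neg hπ.le]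
    congr 1
    push_cast
    ring
  rw [hNorm, ← ENNReal.rpow_natCast, ← ENNReal.rpow_mul]
  norm_num
  have h := lintegral_comp_smul (n := n) (fun ξ => ENNReal.ofReal (Real.exp (2 * κ * ρ ‖ξ‖) *
    ((1 + ‖ξ‖ ^ 2) * ‖fourierHat u₀ ξ‖ ^ 2 + ‖fourierHat u₁ ξ‖ ^ 2))) hπ
  have h2 : ∫⁻ ξ : EuclideanSpace ℝ (Fin n), ENNReal.ofReal (Real.exp (2 * κ * ρ ‖ξ‖) *
    ((1 + ‖ξ‖ ^ 2) * ‖fourierHat u₀ ξ‖ ^ 2 + ‖fourierHat u₁ ξ‖ ^ 2)) =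
      ENNReal.ofReal ((2 * Real.pi) ^ n) * ∫⁻ ξ : EuclideanSpace ℝ (Fin n), ENNReal.ofReal (Real.exp (2 * κ * ρ ‖(2 * Real.pi) • ξ‖) *
    ((1 + ‖(2 * Real.pi) • ξ‖ ^ 2) * ‖fourierHat u₀ ((2 * Real.pi) • ξ)‖ ^ 2 + ‖fourierHat u₁ ((2 * Real.pi) • ξ)‖ ^ 2)) := by
    rw [h, ← mul_assoc, ← ENNReal.ofReal_mul (by positivity),
      mul_inv_cancel₀ (by positivity), ENNReal.ofReal_one, one_mul]
  rw [h2, ← lintegral_const_mul' _ _ ENNReal.ofReal_ne_top]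
  refine lintegral_congr fun η => ?_
  rw [← ENNReal.ofReal_mul (by positivity)]
  congr 1
  have hF : ∀ f : L2 n, ‖fourierHat f ((2 * Real.pi) • η)‖ ^ 2 =
      ((2 * Real.pi) ^ n)⁻¹ * ‖(𝓕 f : L2 n) η‖ ^ 2 := by
    intro f
    rw [fourierHat, inv_smul_smul₀ hπ.ne', norm_mul, mul_pow, Complex.norm_real, Real.norm_eq_abs,
      sq_abs, hc]
  rw [hF, hF, norm_smul, Real.norm_of_nonneg hπ.le]
  field_simp

/-- Bounds for the Fourier modes give an energy estimate. -/
theorem IsSolution.energy_le {b ρ : ℝ → ℝ} {u₀ u₁ : L2 n} {u : ℝ → L2 n}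
    (h : IsSolution b u₀ u₁ u) (hb : ContinuousOn b (Ici 0)) {κ K t : ℝ} (ht : 0 ≤ t) (hK : 0 ≤ K)
    (hfin : hNorm ρ κ u₀ u₁ ≠ ⊤)
    (hmode : ∀ (r : ℝ) (y v : ℝ → ℝ), 0 ≤ r → IsModeOn b r 0 t y v →
      r ^ 2 * y t ^ 2 + v t ^ 2 ≤
        K * Real.exp (2 * κ * ρ r) * ((1 + r ^ 2) * y 0 ^ 2 + v 0 ^ 2)) :
    energy u t ≤ K * (hNorm ρ κ u₀ u₁).toReal ^ 2 := by
  -- The factor 1/2 in the energy compensates the 2 lost in the superposition of modes.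
  have hE : ENNReal.ofReal (2 * energy u t) ≤ ENNReal.ofReal (2 * K) * hNorm ρ κ u₀ u₁ ^ 2 := by
    have e : 2 * energy u t = (∑ j, ‖weakPartial j (u t)‖ ^ 2) + ‖timeDeriv u t‖ ^ 2 := by
      rw [energy]; ring
    have hmeas : ∀ f : L2 n, AEMeasurable
        (fun η => ENNReal.ofReal (‖(𝓕 f : L2 n) η‖ ^ 2)) := fun f =>
      ((Lp.aestronglyMeasurable _).norm.aemeasurable.pow_const 2).ennreal_ofReal
    rw [e, ENNReal.ofReal_add (by positivity) (by positivity),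
      ENNReal.ofReal_sum_of_nonneg fun _ _ => by positivity]
    simp only [ofReal_norm_sq]
    rw [← lintegral_finsetSum' _ fun j _ => hmeas _, ← lintegral_add_right' _ (hmeas _), hNorm_sq,
      ← lintegral_const_mul' _ _ ENNReal.ofReal_ne_top]
    refine lintegral_mono_ae ?_
    filter_upwards [sum_norm_sq_weakPartial (h.memH1 t ht), h.ae_mode_le hb ht hmode]
      with η h1 h2
    rw [← ENNReal.ofReal_sum_of_nonneg fun _ _ => by positivity, h1,
      ← ENNReal.ofReal_add (by positivity) (by positivity), ← ENNReal.ofReal_mul (by positivity)]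
    exact ENNReal.ofReal_le_ofReal (h2.trans_eq (by ring))
  rw [← ENNReal.ofReal_toReal (ENNReal.pow_ne_top hfin), ← ENNReal.ofReal_mul (by positivity),
    ENNReal.ofReal_le_ofReal_iff (by positivity), ENNReal.toReal_pow] at hE
  linarith

end DissipativeWave

theorem theorem2p2 (n m : ℕ) (hm : 1 ≤ m)
    (ρ : ℝ → ℝ) (hρ : IsWeight ρ)
    (b μ : ℝ → ℝ)
    (hA1 : NonEffectiveDamping b μ)
    (hA2 : Stabilization (fun t => b t - μ t))
    (hA3 : ContDiffOn ℝ m b (Ici 0))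
    (Θ Ξ : ℝ → ℝ)
    (hΘ_pos : ∀ t, 0 ≤ t → 0 < Θ t)
    (hΘ_mono : StrictMonoOn Θ (Ici 0))
    (hΘ_cont : ContinuousOn Θ (Ici 0))
    (hΞ_pos : ∀ t, 0 ≤ t → 0 < Ξ t)
    (hΞ_mono : MonotoneOn Ξ (Ici 0) ∨ AntitoneOn Ξ (Ici 0))
    (hΞ_cont : ContinuousOn Ξ (Ici 0))
    -- `ζ⁻¹(Θ(t))` is defined for every `t ≥ 0`
    (hΘ_range : ∀ t, 0 ≤ t → Θ t ∈ zeta ρ '' Ici 0)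
    (h_stb : ∀ t, 0 ≤ t →
      ∫ s in Ioi t, |tailIntegral (fun τ => b τ - μ τ) s| ≤ (Θ t)⁻¹)
    (h_Cm : ∀ k : ℕ, k ≤ m → ∀ t, 0 ≤ t →
      |iteratedDerivWithin k b (Ici 0) t| ≤ Ξ t ^ (k + 1))
    (h_XiTh : BddAbove ((fun t => Ξ t / zetaInv ρ (Θ t)) '' Ici 0))
    (h_ass : BddAbove ((fun t => Θ t / zetaInv ρ (Θ t) ^ (m + 1) *
      ∫ s in (0 : ℝ)..t, Ξ s ^ (m + 1)) '' Ici 0)) :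
    ∃ κ₀ : ℝ, 0 < κ₀ ∧ ∃ C : ℝ, 0 < C ∧
      ∀ u₀ u₁ : L2 n, (u₀, u₁) ∈ hSpaceTop n ρ →
      ∀ u : ℝ → L2 n, IsSolution b u₀ u₁ u →
      ∀ t, 0 ≤ t →
        energy u t ≤ C * (hNorm ρ κ₀ u₀ u₁).toReal ^ 2 *
          Real.exp (-∫ s in (0 : ℝ)..t, μ s) := by
  obtain ⟨κ, hκ, C, hC, hmode⟩ := exists_mode_energy_le hm hρ hA1 hA2 hA3 hΘ_pos hΘ_mono hΘ_cont
    hΞ_pos hΞ_cont hΘ_range h_stb h_Cm h_XiTh h_ass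
  refine ⟨κ, hκ, C, hC, fun u₀ u₁ hu u h t ht => ?_⟩
  have hfin : hNorm ρ κ u₀ u₁ ≠ ∞ := (mem_iInter₂.1 hu κ hκ).2.ne
  -- At fixed t the decay factor does not depend on the frequency, so it passes through the
  -- ξ-integral as part of the constant.
  refine (h.energy_le hA3.continuousOn ht (K := C * Real.exp (-∫ s in (0 : ℝ)..t, μ s))
    (by positivity) hfin fun r y v hr hyv => ?_).trans_eq (by ring)
  exact (hmode r t y v hr ht hyv).trans_eq (by ring)
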